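/- Let $(M^n,g)$, $n\ge 3$, be a compact smooth Riemannian manifold (without boundary), with Ricci tensor $Ric$, scalar curvature $R$, Schouten tensor $A_g=\frac{1}{n-2}\left(Ric-\frac{R}{2(n-1)}g\right)$ and, for a fixed integer $1\le k\le n$, $\sigma_k$-curvature $\sigma_k$, i.e. the $k$-th elementary symmetric function of the eigenvalues of $g^{-1}A_g$. Suppose that $(M,g,X,\lambda)$ is a quasi $k$-Yamabe soliton: $X$ is a smooth vector field on $M$ and $m\neq 0$, $\lambda$ are real constants such that $$\tfrac12\mathcal L_Xg-\tfrac1m X^\flat\otimes X^\flat=(\sigma_k-\lambda)g .$$ Let $X=\nabla h+Y$ be the Hodge–de Rham decomposition of $X$, i.e. $h$ is a smooth function on $M$ and $Y$ is a smooth vector field on $M$ with $\operatorname{div}Y=0$. Then the soliton is gradient (that is, $X=\nabla f$ for some smooth function $f:M\to\mathbb R$) if and only if $$\int_M\Big[Ric(\nabla h,Y)+\frac1m g(\nabla^2h,X^\flat\otimes X^\flat)-\frac2m g(\nabla^2h,dh\otimes dh)+\frac1{m^2}|dh\otimes dh|^2+\frac{n}{2m}(\sigma_k-\lambda)|X|^2+\frac2m(\sigma_k-\lambda)|\nabla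 h|^2+\frac{3}{2m^2}|X|^4\Big]\,dv_g\le 0 .$$ -/

import Mathlib

open Bundle MeasureTheory
open scoped Manifold ContDiff Matrix

noncomputable section

namespace QuasiYamabe

/-- The model space `ℝⁿ`. -/
abbrev Model (n : ℕ) : Type := EuclideanSpace ℝ (Fin n)

/-- Smooth Riemannian metrics on an `n`-dimensional manifold `M` (without boundary). -/
abbrev Metric (n : ℕ) (M : Type*) [TopologicalSpace M] [ChartedSpace (Model n) M]
    [IsManifold (𝓡 n) ∞ M] : Type _ :=
  ContMDiffRiemannianMetric (𝓡 n) ∞ (Model n) (fun x : M ↦ TangentSpace (𝓡 n) x)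

/-- Vector fields on `M`, with no regularity imposed. -/
abbrev VField (n : ℕ) (M : Type*) [TopologicalSpace M] [ChartedSpace (Model n) M] : Type _ :=
  (x : M) → TangentSpace (𝓡 n) x

/-- The partial derivative `∂ᵢ f` of a function on `ℝⁿ`. -/
def pd {n : ℕ} (i : Fin n) (f : Model n → ℝ) (y : Model n) : ℝ :=
  fderiv ℝ f y (EuclideanSpace.single i 1)

section

variable {n : ℕ} {M : Type*} [TopologicalSpace M] [ChartedSpace (Model n) M]

instance instFiniteDimensionalTangent (x : M) : FiniteDimensional ℝ (TangentSpace (𝓡 n) x) :=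
  inferInstanceAs (FiniteDimensional ℝ (EuclideanSpace ℝ (Fin n)))

/-- A vector field is smooth if it is smooth as a section of the tangent bundle. -/
def IsSmoothField [IsManifold (𝓡 n) ∞ M] (X : VField n M) : Prop :=
  ContMDiff (𝓡 n) (𝓡 n).tangent ∞ (fun x ↦ (⟨x, X x⟩ : TangentBundle (𝓡 n) M))

/-! ### Coordinate expressions

For `c : M`, the preferred chart `φ` at `c` gives local coordinates; `y` ranges over the target of
`φ`, an open subset of `ℝⁿ`, and stands for the point `φ⁻¹ y` of `M`. -/

/-- The coordinate vector field `∂ᵢ` of the chart at `c`, at the point `φ⁻¹ y`. -/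
def coordVec (c : M) (y : Model n) (i : Fin n) :
    TangentSpace (𝓡 n) ((extChartAt (𝓡 n) c).symm y) :=
  mfderiv 𝓘(ℝ, Model n) (𝓡 n) (extChartAt (𝓡 n) c).symm y
    (EuclideanSpace.single i 1 : Model n)

/-- The components `Xⁱ` of a vector field: the coordinates of `dφ(X)`. -/
def vecCoord (c : M) (X : VField n M) (y : Model n) (i : Fin n) : ℝ :=
  mvfderiv (𝓡 n) (extChartAt (𝓡 n) c) ((extChartAt (𝓡 n) c).symm y)
    (X ((extChartAt (𝓡 n) c).symm y)) i

/-- The components `∂ᵢ h` of `dh`. -/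
def diffCoord (c : M) (h : M → ℝ) (y : Model n) (i : Fin n) : ℝ :=
  pd i (fun z ↦ h ((extChartAt (𝓡 n) c).symm z)) y

/-- The coordinates of `p` in the preferred chart at `p`. -/
def base (p : M) : Model n := extChartAt (𝓡 n) p p

/-- The components of `X` at `p`, in the preferred chart at `p`. -/
def vecAt (X : VField n M) (p : M) : Fin n → ℝ := vecCoord p X (base p)

/-- The components of `dh` at `p`, in the preferred chart at `p`. -/
def diffAt (h : M → ℝ) (p : M) : Fin n → ℝ := diffCoord p h (base p)

end

section

variable {n : ℕ} {M : Type*} [TopologicalSpace M] [ChartedSpace (Model n) M]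
  [IsManifold (𝓡 n) ∞ M] (g : Metric n M)

/-- The components `g_{ij} = g(∂ᵢ, ∂ⱼ)` of the metric. -/
def metricCoord (c : M) (y : Model n) : Matrix (Fin n) (Fin n) ℝ :=
  Matrix.of fun i j ↦ g.inner ((extChartAt (𝓡 n) c).symm y) (coordVec c y i) (coordVec c y j)

/-- The Christoffel symbols `Γᵏ_{ij} = ½ gᵏˡ (∂ᵢ g_{jl} + ∂ⱼ g_{il} - ∂ₗ g_{ij})` of the
Levi-Civita connection. -/
def christoffel (c : M) (k i j : Fin n) (y : Model n) : ℝ :=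
  (1 / 2) * ∑ l, (metricCoord g c y)⁻¹ k l *
    (pd i (fun z ↦ metricCoord g c z j l) y + pd j (fun z ↦ metricCoord g c z i l) y
      - pd l (fun z ↦ metricCoord g c z i j) y)

/-- The components `∇ᵢ Xᵏ = ∂ᵢ Xᵏ + Γᵏ_{ij} Xʲ` of the covariant derivative of a vector field. -/
def covCoord (c : M) (X : VField n M) (y : Model n) (i k : Fin n) : ℝ :=
  pd i (fun z ↦ vecCoord c X z k) y + ∑ j, christoffel g c k i j y * vecCoord c X y j

/-- The Hessian `(∇²h)_{ij} = ∂ᵢ∂ⱼ h - Γᵏ_{ij} ∂ₖ h`. -/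
def hessCoord (c : M) (h : M → ℝ) (y : Model n) : Matrix (Fin n) (Fin n) ℝ :=
  Matrix.of fun i j ↦
    pd i (fun z ↦ diffCoord c h z j) y - ∑ k, christoffel g c k i j y * diffCoord c h y k

/-- The Lie derivative `(𝓛_X g)_{ij} = Xᵏ ∂ₖ g_{ij} + g_{kj} ∂ᵢ Xᵏ + g_{ik} ∂ⱼ Xᵏ`. -/
def lieCoord (c : M) (X : VField n M) (y : Model n) : Matrix (Fin n) (Fin n) ℝ :=
  Matrix.of fun i j ↦
    ∑ k, (vecCoord c X y k * pd k (fun z ↦ metricCoord g c z i j) y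
      + metricCoord g c y k j * pd i (fun z ↦ vecCoord c X z k) y
      + metricCoord g c y i k * pd j (fun z ↦ vecCoord c X z k) y)

/-- The Ricci tensor
`R_{jk} = ∂ᵢ Γⁱ_{jk} - ∂ⱼ Γⁱ_{ik} + Γⁱ_{il} Γˡ_{jk} - Γⁱ_{jl} Γˡ_{ik}`
(positive on round spheres). -/
def ricciCoord (c : M) (y : Model n) : Matrix (Fin n) (Fin n) ℝ :=
  Matrix.of fun j k ↦
    ∑ i, (pd i (christoffel g c i j k) y - pd j (christoffel g c i i k) y
      + ∑ l, (christoffel g c i i l y * christoffel g c l j k y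
        - christoffel g c i j l y * christoffel g c l i k y))

/-! ### Tensors at a point

Tensors at `p` are given by their components in the preferred chart at `p`. -/

/-- The metric at `p`. -/
def metricAt (p : M) : Matrix (Fin n) (Fin n) ℝ := metricCoord g p (base p)

/-- The Hessian `∇²h` at `p`. -/
def hess (h : M → ℝ) (p : M) : Matrix (Fin n) (Fin n) ℝ := hessCoord g p h (base p)

/-- The Lie derivative `𝓛_X g` at `p`. -/
def lieMetric (X : VField n M) (p : M) : Matrix (Fin n) (Fin n) ℝ := lieCoord g p X (base p)

/-- The Ricci tensor at `p`. -/
def ricci (p : M) : Matrix (Fin n) (Fin n) ℝ := ricciCoord g p (base p)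

/-- The value `Ric(X, Y)` at `p`. -/
def ricciApply (X Y : VField n M) (p : M) : ℝ :=
  ∑ i, ∑ j, ricci g p i j * vecAt X p i * vecAt Y p j

/-- The components `Xᵢ = g_{ij} Xʲ` of the one-form `X♭` at `p`. -/
def flat (X : VField n M) (p : M) : Fin n → ℝ := metricAt g p *ᵥ vecAt X p

/-- The divergence `div X = tr ∇X = ∇ᵢ Xⁱ`. -/
def divergence (X : VField n M) (p : M) : ℝ := ∑ i, covCoord g p X (base p) i i

/-- The inner product `g(A, B) = gⁱᵏ gʲˡ A_{ij} B_{kl}` of two covariant 2-tensors at `p`. -/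
def tensorInner (p : M) (A B : Matrix (Fin n) (Fin n) ℝ) : ℝ :=
  ∑ i, ∑ j, ∑ k, ∑ l, (metricAt g p)⁻¹ i k * (metricAt g p)⁻¹ j l * A i j * B k l

/-- The squared norm `|X|² = g(X, X)`. -/
def normSq (X : VField n M) (p : M) : ℝ := g.inner p (X p) (X p)

/-- The scalar curvature `R = gⁱʲ R_{ij}`. -/
def scalar (p : M) : ℝ := ∑ i, ∑ j, (metricAt g p)⁻¹ i j * ricci g p i j

/-- The Schouten tensor `A = (Ric - R / (2 (n - 1)) g) / (n - 2)`, for `n ≥ 3`. -/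
def schouten (p : M) : Matrix (Fin n) (Fin n) ℝ :=
  (1 / ((n : ℝ) - 2)) • (ricci g p - (scalar g p / (2 * ((n : ℝ) - 1))) • metricAt g p)

/-- The `σ_k`-curvature: the `k`-th elementary symmetric function of the eigenvalues, with
multiplicity, of `g⁻¹ A` (they are real, as `g⁻¹ A` is self-adjoint with respect to `g`). -/
def sigma (k : ℕ) (p : M) : ℝ :=
  ((metricAt g p)⁻¹ * schouten g p).charpoly.roots.esymm k

/-! ### Gradient -/

/-- The metric at `p` as a bilinear form on the tangent space. -/
def metricForm (p : M) : LinearMap.BilinForm ℝ (TangentSpace (𝓡 n) p) :=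
  LinearMap.mk₂ ℝ (fun v w ↦ g.inner p v w) (by simp) (by simp) (by simp) (by simp)

theorem metricForm_nondegenerate (p : M) : (metricForm g p).Nondegenerate := by
  constructor
  · intro v hv
    by_contra h
    exact (g.pos p v h).ne' (hv v)
  · intro v hv
    by_contra h
    exact (g.pos p v h).ne' (hv v)

/-- The gradient of `h`: `g(∇h, w) = dh(w)` for every tangent vector `w`. -/
def grad (h : M → ℝ) : VField n M := fun p ↦
  ((metricForm g p).toDual (metricForm_nondegenerate g p)).symm
    (mvfderiv (𝓡 n) h p : TangentSpace (𝓡 n) p →ₗ[ℝ] ℝ)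

/-- `X` is a gradient field: `X = ∇f` for a smooth function `f`. -/
def IsGradientField (X : VField n M) : Prop :=
  ∃ f : M → ℝ, ContMDiff (𝓡 n) 𝓘(ℝ, ℝ) ∞ f ∧ ∀ p, X p = grad g f p

/-! ### Riemannian volume -/

/-- The measure `√(det g_{ij}) dy¹ ⋯ dyⁿ` of the chart at `c`, carried to the domain of that chart
and extended by zero to `M`. -/
def chartVolume [MeasurableSpace M] (c : M) : Measure M :=
  ((volume.restrict (extChartAt (𝓡 n) c).target).withDensity
    (fun y ↦ ENNReal.ofReal √(metricCoord g c y).det)).map (extChartAt (𝓡 n) c).symm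

/-- The Riemannian volume measure `dv_g`. The measures of two charts agree on the overlap of their
domains; the measure on `M` glued from them is their least upper bound. -/
def riemannianVolume [MeasurableSpace M] : Measure M := ⨆ c : M, chartVolume g c

/-! ### Solitons -/

/-- `(M, g, X, lam)` is a quasi `k`-Yamabe soliton with constant `m ≠ 0`:
`X` is smooth and `½ 𝓛_X g - (1/m) X♭ ⊗ X♭ = (σ_k - lam) g`. -/
structure IsQuasiYamabeSoliton (k : ℕ) (m lam : ℝ) (X : VField n M) : Prop where
  m_ne_zero : m ≠ 0
  smooth : IsSmoothField X
  equation : ∀ p, (1 / 2 : ℝ) • lieMetric g X p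
      - (1 / m) • Matrix.vecMulVec (flat g X p) (flat g X p)
    = (sigma g k p - lam) • metricAt g p

/-- `X = ∇h + Y` with `h` and `Y` smooth and `div Y = 0`: the Hodge-de Rham decomposition of `X`. -/
structure IsHodgeDecomposition (X : VField n M) (h : M → ℝ) (Y : VField n M) : Prop where
  smooth_potential : ContMDiff (𝓡 n) 𝓘(ℝ, ℝ) ∞ h
  smooth_field : IsSmoothField Y
  decomposition : ∀ p, X p = grad g h p + Y p
  divergence_free : ∀ p, divergence g Y p = 0

end

end QuasiYamabe

end

open QuasiYamabe

/-! Write s = σ_k − λ, and let T = ∇²h − (1/m) dh ⊗ dh − s g measure how far h is from solving the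
gradient soliton equation. The integrand equals |T|² + div(∇_{∇h} Y) + (1/(2m)) div(|X|² X)
(`integrand_eq`), so on a closed manifold its integral is ∫|T|², and the criterion amounts to T = 0.

The identity has three sources. Since div Y = 0, commuting covariant derivatives gives div(∇_{∇h} Y)
= tr(∇∇h ∘ ∇Y) + Ric(∇h, Y) (`divergence_covField`). Pairing the soliton equation with ∇²h expresses
this trace through ∇²h(X, X), s Δh and |∇²h|² (`trace_mul_of_soliton`). Finally, the trace of the
equation and its value on (X, X) give Δh = div X = |X|²/m + n s and a formula for div(|X|² X), which
account for all remaining terms.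

If the integral is nonpositive, then T = 0. The trace of T is (|X|² − |∇h|²)/m (`sq_le_defect`), so
|X| = |∇h|, that is, |Y|² = −2⟨∇h, Y⟩. As ⟨∇h, Y⟩ = div(hY), integration gives Y = 0. Conversely, if
X = ∇f then Y = ∇f − ∇h is L²-orthogonal to gradients, hence to itself; so Y = 0, and T = 0 is the
soliton equation.

Most of the work goes into the divergence theorem (`integral_divergence_eq_zero`). Tensors are given
at each point in the preferred chart of that point, so ∇X must first be shown to transform as an
endomorphism (`covLin_transition`); only then are traces of it continuous functions. Ric and σ_k
need no transformation law: Ric enters through a pointwise identity, and σ_k is controlled by the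
trace of the soliton equation (`IsQuasiYamabeSoliton.continuous_sigma`). -/

noncomputable section

namespace QuasiYamabe

/-! ### Fields, functions and the metric read in a chart; smoothness. -/

section Charts

open Set Filter Topology

variable {n : ℕ} {M : Type*} [TopologicalSpace M] [ChartedSpace (Model n) M]

/-- The vector field `X` read in the chart at `c`. -/
def fieldRep (c : M) (X : VField n M) (y : Model n) : Model n :=
  mvfderiv (𝓡 n) (extChartAt (𝓡 n) c) ((extChartAt (𝓡 n) c).symm y)
    (X ((extChartAt (𝓡 n) c).symm y))

/-- The function `f` read in the chart at `c`. -/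
def funRep (c : M) (f : M → ℝ) (y : Model n) : ℝ := f ((extChartAt (𝓡 n) c).symm y)

/-- The change of coordinates from the chart at `c` to the chart at `d`. -/
def transition (c d : M) (y : Model n) : Model n :=
  extChartAt (𝓡 n) d ((extChartAt (𝓡 n) c).symm y)

theorem isOpen_chartTarget (c : M) : IsOpen (extChartAt (𝓡 n) c).target :=
  isOpen_extChartAt_target c

theorem base_mem_target (p : M) : (base p : Model n) ∈ (extChartAt (𝓡 n) p).target :=
  mem_extChartAt_target p

@[simp] theorem chart_symm_base (p : M) : (extChartAt (𝓡 n) p).symm (base p) = p :=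
  extChartAt_to_inv p

theorem fieldRep_chart {c p : M} (hp : p ∈ (extChartAt (𝓡 n) c).source) (X : VField n M) :
    fieldRep c X (extChartAt (𝓡 n) c p) = mvfderiv (𝓡 n) (extChartAt (𝓡 n) c) p (X p) := by
  obtain ⟨y, hy, rfl⟩ : ∃ y ∈ (extChartAt (𝓡 n) c).target, (extChartAt (𝓡 n) c).symm y = p :=
    ⟨_, (extChartAt (𝓡 n) c).map_source hp, (extChartAt (𝓡 n) c).left_inv hp⟩
  rw [(extChartAt (𝓡 n) c).right_inv hy]
  rfl

/-- The field `X` is given by a smooth function in each chart. -/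
def SmoothInCharts (X : VField n M) : Prop :=
  ∀ c, ContDiffOn ℝ ∞ (fieldRep c X) (extChartAt (𝓡 n) c).target

theorem SmoothInCharts.differentiableAt {X : VField n M} (hX : SmoothInCharts X) {c : M}
    {y : Model n} (hy : y ∈ (extChartAt (𝓡 n) c).target) :
    DifferentiableAt ℝ (fieldRep c X) y :=
  ((hX c).contDiffAt ((isOpen_chartTarget c).mem_nhds hy)).differentiableAt (by simp)

theorem fderiv_coord {f : Model n → Model n} {y : Model n} (hf : DifferentiableAt ℝ f y)
    (u : Model n) (k : Fin n) : fderiv ℝ (fun z ↦ f z k) y u = fderiv ℝ f y u k := by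
  have h := (EuclideanSpace.proj k : Model n →L[ℝ] ℝ).hasFDerivAt.comp y hf.hasFDerivAt
  exact congrArg (fun L ↦ L u) h.fderiv

theorem pd_vecCoord {X : VField n M} (hX : SmoothInCharts X) {c : M} {y : Model n}
    (hy : y ∈ (extChartAt (𝓡 n) c).target) (i k : Fin n) :
    pd i (fun z ↦ vecCoord c X z k) y =
      fderiv ℝ (fieldRep c X) y (EuclideanSpace.single i 1) k :=
  fderiv_coord (hX.differentiableAt hy) _ k

variable [IsManifold (𝓡 n) ∞ M]

theorem mfderiv_symm_comp {c : M} {y : Model n} (hy : y ∈ (extChartAt (𝓡 n) c).target)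
    (v : TangentSpace (𝓡 n) ((extChartAt (𝓡 n) c).symm y)) :
    mfderiv 𝓘(ℝ, Model n) (𝓡 n) (extChartAt (𝓡 n) c).symm y
      (mvfderiv (𝓡 n) (extChartAt (𝓡 n) c) ((extChartAt (𝓡 n) c).symm y) v) = v := by
  have := mfderivWithin_extChartAt_symm_comp_mfderiv_extChartAt (I := 𝓡 n) hy
  rw [ModelWithCorners.range_eq_univ, mfderivWithin_univ] at this
  exact congrArg (fun L ↦ L v) this

theorem mvfderiv_comp_symm {c : M} {y : Model n} (hy : y ∈ (extChartAt (𝓡 n) c).target)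
    (v : Model n) :
    mvfderiv (𝓡 n) (extChartAt (𝓡 n) c) ((extChartAt (𝓡 n) c).symm y)
      (mfderiv 𝓘(ℝ, Model n) (𝓡 n) (extChartAt (𝓡 n) c).symm y v) = v := by
  have := mfderiv_extChartAt_comp_mfderivWithin_extChartAt_symm (I := 𝓡 n) hy
  rw [ModelWithCorners.range_eq_univ, mfderivWithin_univ] at this
  exact congrArg (fun L ↦ L v) this

theorem mvfderiv_chart_injective {c p : M} (hp : p ∈ (extChartAt (𝓡 n) c).source) :
    Function.Injective (mvfderiv (𝓡 n) (extChartAt (𝓡 n) c) p) := by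
  obtain ⟨y, hy, rfl⟩ : ∃ y ∈ (extChartAt (𝓡 n) c).target, (extChartAt (𝓡 n) c).symm y = p :=
    ⟨_, (extChartAt (𝓡 n) c).map_source hp, (extChartAt (𝓡 n) c).left_inv hp⟩
  exact Function.LeftInverse.injective (mfderiv_symm_comp hy)

theorem mvfderiv_chart_surjective {c p : M} (hp : p ∈ (extChartAt (𝓡 n) c).source) :
    Function.Surjective (mvfderiv (𝓡 n) (extChartAt (𝓡 n) c) p) := by
  obtain ⟨y, hy, rfl⟩ : ∃ y ∈ (extChartAt (𝓡 n) c).target, (extChartAt (𝓡 n) c).symm y = p :=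
    ⟨_, (extChartAt (𝓡 n) c).map_source hp, (extChartAt (𝓡 n) c).left_inv hp⟩
  exact Function.RightInverse.surjective (mvfderiv_comp_symm hy)

theorem contMDiffOn_chart_symm (c : M) :
    ContMDiffOn 𝓘(ℝ, Model n) (𝓡 n) ∞ (extChartAt (𝓡 n) c).symm (extChartAt (𝓡 n) c).target :=
  contMDiffOn_extChartAt_symm c

theorem mdifferentiableAt_chart_symm {c : M} {y : Model n}
    (hy : y ∈ (extChartAt (𝓡 n) c).target) :
    MDifferentiableAt 𝓘(ℝ, Model n) (𝓡 n) (extChartAt (𝓡 n) c).symm y :=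
  ((contMDiffOn_chart_symm c).contMDiffAt ((isOpen_chartTarget c).mem_nhds hy)).mdifferentiableAt
    (by simp)

theorem mdifferentiableAt_chart {c p : M} (hp : p ∈ (extChartAt (𝓡 n) c).source) :
    MDifferentiableAt (𝓡 n) 𝓘(ℝ, Model n) (extChartAt (𝓡 n) c) p :=
  mdifferentiableAt_extChartAt (by simpa using hp)

/-- Over the chart domain, the tangent bundle trivialization at `c` is the derivative of the chart
at `c`, so `fieldRep` is the trivialized section composed with the inverse chart. -/
theorem IsSmoothField.smoothInCharts {X : VField n M} (hX : IsSmoothField X) :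
    SmoothInCharts X := by
  intro c
  rw [← contMDiffOn_iff_contDiffOn]
  have h1 := (Trivialization.contMDiffOn_section_baseSet_iff (n := ∞) (s := X) (IB := 𝓡 n)
    (trivializationAt (Model n) (TangentSpace (𝓡 n)) c)).1 (ContMDiff.contMDiffOn hX)
  have h2 : ContMDiffOn (𝓡 n) 𝓘(ℝ, Model n) ∞
      (fun x ↦ mvfderiv (𝓡 n) (extChartAt (𝓡 n) c) x (X x)) (extChartAt (𝓡 n) c).source := by
    refine (h1.congr ?_).mono ?_
    · intro x hx
      have hx' : x ∈ (chartAt (Model n) c).source := by simpa using hx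
      have := TangentBundle.continuousLinearMapAt_trivializationAt (I := 𝓡 n) hx'
      have h3 := congrArg (fun L ↦ L (X x)) this
      exact h3.symm.trans (by
        rw [Trivialization.continuousLinearMapAt_apply, Trivialization.coe_linearMapAt_of_mem _ hx])
    · intro x hx
      simpa using hx
  exact h2.comp (contMDiffOn_chart_symm c) (fun y hy ↦ (extChartAt (𝓡 n) c).map_target hy)

theorem contDiffOn_funRep {f : M → ℝ} (hf : ContMDiff (𝓡 n) 𝓘(ℝ, ℝ) ∞ f) (c : M) :
    ContDiffOn ℝ ∞ (funRep c f) (extChartAt (𝓡 n) c).target := by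
  rw [← contMDiffOn_iff_contDiffOn]
  exact hf.comp_contMDiffOn (contMDiffOn_chart_symm c)

/-- In the trivialization at `c` the coordinate field is the constant basis vector. -/
theorem contMDiffOn_coordVec (c : M) (i : Fin n) :
    ContMDiffOn 𝓘(ℝ, Model n) (𝓡 n).tangent ∞
      (fun y ↦ (⟨(extChartAt (𝓡 n) c).symm y, coordVec c y i⟩ : TangentBundle (𝓡 n) M))
      (extChartAt (𝓡 n) c).target := by
  refine (Trivialization.contMDiffOn_iff
    (e := trivializationAt (Model n) (TangentSpace (𝓡 n)) c) ?_).2 ⟨contMDiffOn_chart_symm c, ?_⟩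
  · intro y hy
    have := (extChartAt (𝓡 n) c).map_target hy
    rw [Trivialization.mem_source]
    simpa using this
  · refine (contMDiffOn_const (c := (EuclideanSpace.single i 1 : Model n))).congr ?_
    intro y hy
    have hx := (extChartAt (𝓡 n) c).map_target hy
    have hx' : (extChartAt (𝓡 n) c).symm y ∈ (chartAt (Model n) c).source := by simpa using hx
    have h3 := congrArg (fun L ↦ L (coordVec c y i))
      (TangentBundle.continuousLinearMapAt_trivializationAt (I := 𝓡 n) hx')
    have h4 := h3.trans (mvfderiv_comp_symm hy (EuclideanSpace.single i 1))
    refine Eq.trans ?_ h4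
    rw [Trivialization.continuousLinearMapAt_apply, Trivialization.coe_linearMapAt_of_mem]
    simpa using hx

theorem contDiffOn_metricCoord (g : Metric n M) (c : M) (i j : Fin n) :
    ContDiffOn ℝ ∞ (fun y ↦ metricCoord g c y i j) (extChartAt (𝓡 n) c).target := by
  rw [← contMDiffOn_iff_contDiffOn]
  let _ : RiemannianBundle (fun x : M ↦ TangentSpace (𝓡 n) x) := ⟨g.toRiemannianMetric⟩
  exact ContMDiffOn.inner_bundle (contMDiffOn_coordVec c i) (contMDiffOn_coordVec c j)

end Charts

/-! ### Changes of coordinates and their action on tangent vectors. -/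

section Transition

open Set Filter Topology

variable {n : ℕ} {M : Type*} [TopologicalSpace M] [ChartedSpace (Model n) M]

/-- The part of the target of the chart at `c` that corresponds to the domain of the chart
at `d`. -/
def overlap (c d : M) : Set (Model n) :=
  (extChartAt (𝓡 n) c).target ∩ (extChartAt (𝓡 n) c).symm ⁻¹' (extChartAt (𝓡 n) d).source

theorem isOpen_overlap (c d : M) : IsOpen (overlap c d : Set (Model n)) :=
  (continuousOn_extChartAt_symm c).isOpen_inter_preimage (isOpen_chartTarget c)
    (isOpen_extChartAt_source d)

theorem chart_mem_overlap {c d p : M} (hc : p ∈ (extChartAt (𝓡 n) c).source)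
    (hd : p ∈ (extChartAt (𝓡 n) d).source) :
    extChartAt (𝓡 n) c p ∈ (overlap c d : Set (Model n)) :=
  ⟨(extChartAt (𝓡 n) c).map_source hc, by
    rwa [mem_preimage, (extChartAt (𝓡 n) c).left_inv hc]⟩

theorem chart_symm_transition {c d : M} {y : Model n} (hy : y ∈ overlap c d) :
    (extChartAt (𝓡 n) d).symm (transition c d y) = (extChartAt (𝓡 n) c).symm y :=
  (extChartAt (𝓡 n) d).left_inv hy.2

theorem transition_mem_target {c d : M} {y : Model n} (hy : y ∈ overlap c d) :
    transition c d y ∈ (extChartAt (𝓡 n) d).target :=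
  (extChartAt (𝓡 n) d).map_source hy.2

theorem transition_transition {c d : M} {y : Model n} (hy : y ∈ overlap c d) :
    transition d c (transition c d y) = y := by
  rw [transition, chart_symm_transition hy]
  exact (extChartAt (𝓡 n) c).right_inv hy.1

theorem transition_chart {c d p : M} (hc : p ∈ (extChartAt (𝓡 n) c).source) :
    transition c d (extChartAt (𝓡 n) c p) = extChartAt (𝓡 n) d p := by
  rw [transition, (extChartAt (𝓡 n) c).left_inv hc]

variable [IsManifold (𝓡 n) ∞ M]

theorem contDiffAt_transition {c d : M} {y : Model n} (hy : y ∈ overlap c d) :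
    ContDiffAt ℝ ∞ (transition c d) y := by
  have := contDiffOn_ext_coord_change (I := 𝓡 n) (n := ∞) d c
  refine (this.mono ?_).contDiffAt ((isOpen_overlap c d).mem_nhds hy)
  intro z hz
  simpa [PartialEquiv.trans_source, overlap] using hz

theorem mvfderiv_chart_eq_fderiv_transition {c d : M} {y : Model n} (hy : y ∈ overlap c d)
    (v : TangentSpace (𝓡 n) ((extChartAt (𝓡 n) c).symm y)) :
    mvfderiv (𝓡 n) (extChartAt (𝓡 n) d) ((extChartAt (𝓡 n) c).symm y) v =
      fderiv ℝ (transition c d) y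
        (mvfderiv (𝓡 n) (extChartAt (𝓡 n) c) ((extChartAt (𝓡 n) c).symm y) v) := by
  have h := mfderiv_comp y (mdifferentiableAt_chart hy.2) (mdifferentiableAt_chart_symm hy.1)
  have h' : mfderiv 𝓘(ℝ, Model n) 𝓘(ℝ, Model n)
      ((extChartAt (𝓡 n) d) ∘ (extChartAt (𝓡 n) c).symm) y = fderiv ℝ (transition c d) y :=
    mfderiv_eq_fderiv
  have h2 := congrArg (fun L ↦ L (mvfderiv (𝓡 n) (extChartAt (𝓡 n) c)
    ((extChartAt (𝓡 n) c).symm y) v)) (h'.symm.trans h)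
  refine Eq.trans ?_ h2.symm
  have h3 := mfderiv_symm_comp hy.1 v
  exact congrArg (mvfderiv (𝓡 n) (extChartAt (𝓡 n) d) ((extChartAt (𝓡 n) c).symm y)) h3.symm

theorem fieldRep_transition {c d : M} {y : Model n} (hy : y ∈ overlap c d) (X : VField n M) :
    fieldRep d X (transition c d y) = fderiv ℝ (transition c d) y (fieldRep c X y) := by
  rw [transition, fieldRep_chart hy.2, mvfderiv_chart_eq_fderiv_transition hy]
  rfl

theorem fderiv_transition_bijective {c d : M} {y : Model n} (hy : y ∈ overlap c d) :
    Function.Bijective (fderiv ℝ (transition c d) y) := by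
  constructor
  · intro u v huv
    obtain ⟨u, rfl⟩ := mvfderiv_chart_surjective ((extChartAt (𝓡 n) c).map_target hy.1) u
    obtain ⟨v, rfl⟩ := mvfderiv_chart_surjective ((extChartAt (𝓡 n) c).map_target hy.1) v
    rw [← mvfderiv_chart_eq_fderiv_transition hy, ← mvfderiv_chart_eq_fderiv_transition hy] at huv
    rw [mvfderiv_chart_injective hy.2 huv]
  · intro w
    obtain ⟨v, rfl⟩ := mvfderiv_chart_surjective hy.2 w
    exact ⟨_, (mvfderiv_chart_eq_fderiv_transition hy v).symm⟩

end Transition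

/-! ### The metric in a chart as a bilinear form on ℝⁿ; positivity and smoothness. -/

section MetricForm

open Set Filter Topology

variable {n : ℕ} {M : Type*} [TopologicalSpace M] [ChartedSpace (Model n) M]
  [IsManifold (𝓡 n) ∞ M] (g : Metric n M)

instance instNormedAddCommGroupBilin :
    NormedAddCommGroup (Model n →L[ℝ] Model n →L[ℝ] ℝ) :=
  ContinuousLinearMap.toNormedAddCommGroup

instance instNormedSpaceBilin : NormedSpace ℝ (Model n →L[ℝ] Model n →L[ℝ] ℝ) :=
  ContinuousLinearMap.toNormedSpace

/-- The metric read in the chart at `c`, as a bilinear form on `ℝⁿ`. -/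
def metricBil (c : M) (y : Model n) : Model n →L[ℝ] Model n →L[ℝ] ℝ :=
  ∑ i, ∑ j, metricCoord g c y i j •
    (EuclideanSpace.proj i : Model n →L[ℝ] ℝ).smulRight (EuclideanSpace.proj j : Model n →L[ℝ] ℝ)

theorem metricBil_apply (c : M) (y u v : Model n) :
    metricBil g c y u v = ∑ i, ∑ j, metricCoord g c y i j * u i * v j := by
  simp [metricBil, mul_assoc]

theorem metricBil_single (c : M) (y : Model n) (i j : Fin n) :
    metricBil g c y (EuclideanSpace.single i 1) (EuclideanSpace.single j 1)
      = metricCoord g c y i j := by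
  simp [metricBil_apply]

theorem eq_sum_single (u : Model n) : u = ∑ i, u i • (EuclideanSpace.single i 1 : Model n) := by
  ext j
  simp [Pi.single_apply]

theorem metricBil_eq_inner (c : M) (y u v : Model n) :
    metricBil g c y u v = g.inner ((extChartAt (𝓡 n) c).symm y)
      (mfderiv 𝓘(ℝ, Model n) (𝓡 n) (extChartAt (𝓡 n) c).symm y u)
      (mfderiv 𝓘(ℝ, Model n) (𝓡 n) (extChartAt (𝓡 n) c).symm y v) := by
  have key : ∀ w : Model n, mfderiv 𝓘(ℝ, Model n) (𝓡 n) (extChartAt (𝓡 n) c).symm y w =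
      ∑ i, w i • coordVec c y i := by
    intro w
    conv_lhs => rw [eq_sum_single w]
    exact (map_sum (mfderiv 𝓘(ℝ, Model n) (𝓡 n) (extChartAt (𝓡 n) c).symm y) _ _).trans
      (Finset.sum_congr rfl fun i _ ↦
        map_smul (mfderiv 𝓘(ℝ, Model n) (𝓡 n) (extChartAt (𝓡 n) c).symm y) _ _)
  rw [metricBil_apply, key u, key v]
  simp only [map_sum, map_smul, sum_apply, smul_apply,
    smul_eq_mul, metricCoord, Matrix.of_apply]
  rw [Finset.sum_comm]
  refine Finset.sum_congr rfl fun i _ ↦ ?_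
  rw [Finset.mul_sum]
  exact Finset.sum_congr rfl fun j _ ↦ by ring

theorem metricBil_chart {c p : M} (hp : p ∈ (extChartAt (𝓡 n) c).source)
    (v w : TangentSpace (𝓡 n) p) :
    metricBil g c (extChartAt (𝓡 n) c p) (mvfderiv (𝓡 n) (extChartAt (𝓡 n) c) p v)
      (mvfderiv (𝓡 n) (extChartAt (𝓡 n) c) p w) = g.inner p v w := by
  obtain ⟨y, hy, rfl⟩ : ∃ y ∈ (extChartAt (𝓡 n) c).target, (extChartAt (𝓡 n) c).symm y = p :=
    ⟨_, (extChartAt (𝓡 n) c).map_source hp, (extChartAt (𝓡 n) c).left_inv hp⟩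
  rw [(extChartAt (𝓡 n) c).right_inv hy, metricBil_eq_inner, mfderiv_symm_comp hy,
    mfderiv_symm_comp hy]

theorem metricBil_transition {c d : M} {y : Model n} (hy : y ∈ overlap c d) (u v : Model n) :
    metricBil g c y u v = metricBil g d (transition c d y) (fderiv ℝ (transition c d) y u)
      (fderiv ℝ (transition c d) y v) := by
  have hp := (extChartAt (𝓡 n) c).map_target hy.1
  obtain ⟨u, rfl⟩ := mvfderiv_chart_surjective hp u
  obtain ⟨v, rfl⟩ := mvfderiv_chart_surjective hp v
  rw [← mvfderiv_chart_eq_fderiv_transition hy, ← mvfderiv_chart_eq_fderiv_transition hy,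
    transition, metricBil_chart g hy.2]
  have := metricBil_chart g hp u v
  rwa [(extChartAt (𝓡 n) c).right_inv hy.1] at this

theorem metricBil_symm (c : M) (y u v : Model n) :
    metricBil g c y u v = metricBil g c y v u := by
  rw [metricBil_eq_inner, metricBil_eq_inner, g.symm]

theorem metricBil_pos {c : M} {y : Model n} (hy : y ∈ (extChartAt (𝓡 n) c).target) {u : Model n}
    (hu : u ≠ 0) : 0 < metricBil g c y u u := by
  rw [metricBil_eq_inner]
  refine g.pos _ _ fun h ↦ hu ?_
  have := mvfderiv_comp_symm hy u
  rw [← this, h]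
  exact map_zero (mvfderiv (𝓡 n) (extChartAt (𝓡 n) c) ((extChartAt (𝓡 n) c).symm y))

theorem metricBil_nondegenerate {c : M} {y : Model n} (hy : y ∈ (extChartAt (𝓡 n) c).target)
    {u v : Model n} (h : ∀ w, metricBil g c y u w = metricBil g c y v w) : u = v := by
  by_contra huv
  have := metricBil_pos g hy (sub_ne_zero.2 huv)
  have h0 : metricBil g c y (u - v) = 0 := by
    ext1 w
    simp [h w]
  rw [h0] at this
  exact lt_irrefl _ this

theorem metricCoord_symm (c : M) (y : Model n) (i j : Fin n) :
    metricCoord g c y i j = metricCoord g c y j i := by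
  rw [← metricBil_single, ← metricBil_single, metricBil_symm]

theorem metricCoord_transpose (c : M) (y : Model n) :
    (metricCoord g c y)ᵀ = metricCoord g c y :=
  Matrix.ext fun i j ↦ metricCoord_symm g c y j i

theorem metricCoord_posDef {c : M} {y : Model n} (hy : y ∈ (extChartAt (𝓡 n) c).target) :
    (metricCoord g c y).PosDef := by
  refine Matrix.PosDef.of_dotProduct_mulVec_pos ?_ fun x hx ↦ ?_
  · rw [Matrix.IsHermitian, Matrix.conjTranspose_eq_transpose_of_trivial, metricCoord_transpose]
  · have := metricBil_pos g hy (u := WithLp.toLp 2 x) (by simpa using hx)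
    rw [metricBil_apply] at this
    simp only [star_trivial, dotProduct, Matrix.mulVec, Finset.mul_sum]
    refine this.trans_eq (Finset.sum_congr rfl fun i _ ↦ Finset.sum_congr rfl fun j _ ↦ ?_)
    simp only []
    ring

theorem metricCoord_det_pos {c : M} {y : Model n} (hy : y ∈ (extChartAt (𝓡 n) c).target) :
    0 < (metricCoord g c y).det :=
  (metricCoord_posDef g hy).det_pos

theorem metricCoord_isUnit {c : M} {y : Model n} (hy : y ∈ (extChartAt (𝓡 n) c).target) :
    IsUnit (metricCoord g c y).det :=
  (metricCoord_det_pos g hy).ne'.isUnit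

theorem contDiffOn_metricBil (c : M) :
    ContDiffOn ℝ ∞ (metricBil g c) (extChartAt (𝓡 n) c).target := by
  refine contDiffOn_clm_apply.2 fun u ↦ contDiffOn_clm_apply.2 fun v ↦ ?_
  simp only [metricBil_apply]
  exact ContDiffOn.sum fun i _ ↦ ContDiffOn.sum fun j _ ↦
    ((contDiffOn_metricCoord g c i j).mul contDiffOn_const).mul contDiffOn_const

theorem contDiffOn_metricCoord_det (c : M) :
    ContDiffOn ℝ ∞ (fun y ↦ (metricCoord g c y).det) (extChartAt (𝓡 n) c).target := by
  simp only [Matrix.det_apply']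
  exact ContDiffOn.sum fun σ _ ↦ contDiffOn_const.mul
    (contDiffOn_prod fun i _ ↦ contDiffOn_metricCoord g c _ _)

/-- Cramer's rule: an entry of the adjugate is a determinant whose entries are constants or metric
coefficients, and det g does not vanish on the chart target. -/
theorem contDiffOn_metricCoord_inv (c : M) (i j : Fin n) :
    ContDiffOn ℝ ∞ (fun y ↦ (metricCoord g c y)⁻¹ i j) (extChartAt (𝓡 n) c).target := by
  have h : ∀ y ∈ (extChartAt (𝓡 n) c).target, (metricCoord g c y)⁻¹ i j =
      ((metricCoord g c y).det)⁻¹ *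
        ((metricCoord g c y).updateRow j (Pi.single i 1)).det := by
    intro y hy
    rw [Matrix.inv_def, Ring.inverse_eq_inv', Matrix.smul_apply, Matrix.adjugate_apply, smul_eq_mul]
  refine ContDiffOn.congr ?_ h
  refine ((contDiffOn_metricCoord_det g c).inv fun y hy ↦ (metricCoord_det_pos g hy).ne').mul ?_
  simp only [Matrix.det_apply']
  refine ContDiffOn.sum fun σ _ ↦ contDiffOn_const.mul (contDiffOn_prod fun k _ ↦ ?_)
  by_cases hk : σ k = j
  · simp only [hk, Matrix.updateRow_self]
    exact contDiffOn_const
  · simp only [Matrix.updateRow_ne hk]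
    exact contDiffOn_metricCoord g c _ _

theorem contDiffOn_pd {f : Model n → ℝ} {s : Set (Model n)} (hs : IsOpen s)
    (hf : ContDiffOn ℝ ∞ f s) (i : Fin n) : ContDiffOn ℝ ∞ (pd i f) s := by
  unfold pd
  exact (hf.fderiv_of_isOpen hs (m := ∞) (by simp)).clm_apply contDiffOn_const

theorem contDiffOn_christoffel (c : M) (k i j : Fin n) :
    ContDiffOn ℝ ∞ (christoffel g c k i j) (extChartAt (𝓡 n) c).target := by
  unfold christoffel
  refine contDiffOn_const.mul (ContDiffOn.sum fun l _ ↦ (contDiffOn_metricCoord_inv g c k l).mul ?_)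
  have h := fun i j k ↦ contDiffOn_pd (isOpen_chartTarget c) (contDiffOn_metricCoord g c j k) i
  exact ((h i j l).add (h j i l)).sub (h l i j)

end MetricForm

/-! ### The covariant derivative and its behaviour under changes of chart. -/

section Covariant

open Set Filter Topology

variable {n : ℕ} {M : Type*} [TopologicalSpace M] [ChartedSpace (Model n) M]
  [IsManifold (𝓡 n) ∞ M] (g : Metric n M)

/-- The bilinear form `(u, w) ↦ g(∇_u X, w)` in the chart at `c`. -/
def covLow (c : M) (X : VField n M) (y : Model n) : Model n →L[ℝ] Model n →L[ℝ] ℝ :=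
  (metricBil g c y).comp (fderiv ℝ (fieldRep c X) y) +
    (1 / 2 : ℝ) • ((fderiv ℝ (metricBil g c) y).flip (fieldRep c X y)
      + fderiv ℝ (metricBil g c) y (fieldRep c X y)
      - ((fderiv ℝ (metricBil g c) y).flip (fieldRep c X y)).flip)

theorem covLow_apply (c : M) (X : VField n M) (y u w : Model n) :
    covLow g c X y u w = metricBil g c y (fderiv ℝ (fieldRep c X) y u) w +
      (1 / 2) * (fderiv ℝ (metricBil g c) y u (fieldRep c X y) w
        + fderiv ℝ (metricBil g c) y (fieldRep c X y) u w
        - fderiv ℝ (metricBil g c) y w (fieldRep c X y) u) := by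
  simp [covLow]

theorem differentiableAt_metricBil {c : M} {y : Model n}
    (hy : y ∈ (extChartAt (𝓡 n) c).target) : DifferentiableAt ℝ (metricBil g c) y :=
  ((contDiffOn_metricBil g c).contDiffAt ((isOpen_chartTarget c).mem_nhds hy)).differentiableAt
    (by simp)

theorem fderiv_metricBil_apply {c : M} {y : Model n} (hy : y ∈ (extChartAt (𝓡 n) c).target)
    (u v w : Model n) :
    fderiv ℝ (fun z ↦ metricBil g c z v w) y u = fderiv ℝ (metricBil g c) y u v w := by
  have h := (differentiableAt_metricBil g hy).hasFDerivAt
  have h1 := (h.clm_apply (hasFDerivAt_const v y)).clm_apply (hasFDerivAt_const w y)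
  rw [h1.fderiv]
  simp

theorem fderiv_metricBil_symm {c : M} {y : Model n} (hy : y ∈ (extChartAt (𝓡 n) c).target)
    (u v w : Model n) :
    fderiv ℝ (metricBil g c) y u v w = fderiv ℝ (metricBil g c) y u w v := by
  rw [← fderiv_metricBil_apply g hy, ← fderiv_metricBil_apply g hy]
  simp only [metricBil_symm g c _ v w]

/-- Product and chain rule applied to `metricBil_transition`. The two terms with second derivatives
of the transition map are the obstruction to tensoriality that the Levi-Civita combination removes.
-/
theorem fderiv_metricBil_transition {c d : M} {y : Model n} (hy : y ∈ overlap c d)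
    (u v w : Model n) :
    fderiv ℝ (metricBil g c) y u v w =
      fderiv ℝ (metricBil g d) (transition c d y) (fderiv ℝ (transition c d) y u)
          (fderiv ℝ (transition c d) y v) (fderiv ℝ (transition c d) y w)
        + metricBil g d (transition c d y) (fderiv ℝ (fderiv ℝ (transition c d)) y u v)
          (fderiv ℝ (transition c d) y w)
        + metricBil g d (transition c d y) (fderiv ℝ (transition c d) y v)
          (fderiv ℝ (fderiv ℝ (transition c d)) y u w) := by
  have hev : (fun z ↦ metricBil g c z v w) =ᶠ[𝓝 y] fun z ↦
      metricBil g d (transition c d z) (fderiv ℝ (transition c d) z v)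
        (fderiv ℝ (transition c d) z w) := by
    filter_upwards [(isOpen_overlap c d).mem_nhds hy] with z hz
    exact metricBil_transition g hz v w
  rw [← fderiv_metricBil_apply g hy.1, hev.fderiv_eq]
  have hτ := contDiffAt_transition hy
  have h1 : HasFDerivAt (transition c d) (fderiv ℝ (transition c d) y) y :=
    (hτ.differentiableAt (by simp)).hasFDerivAt
  have h2 : HasFDerivAt (fderiv ℝ (transition c d)) (fderiv ℝ (fderiv ℝ (transition c d)) y) y :=
    ((hτ.fderiv_right (m := ∞) (by simp)).differentiableAt (by simp)).hasFDerivAt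
  have hG := (differentiableAt_metricBil g (transition_mem_target hy)).hasFDerivAt.comp y h1
  have h3 := (hG.clm_apply (h2.clm_apply (hasFDerivAt_const v y))).clm_apply
    (h2.clm_apply (hasFDerivAt_const w y))
  have h4 := h3.fderiv
  simp only [Function.comp_apply] at h4
  rw [h4]
  simp
  ring

theorem fderiv_fderiv_transition_symm {c d : M} {y : Model n} (hy : y ∈ overlap c d)
    (u v : Model n) :
    fderiv ℝ (fderiv ℝ (transition c d)) y u v = fderiv ℝ (fderiv ℝ (transition c d)) y v u :=
  ((contDiffAt_transition hy).isSymmSndFDerivAt (by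
    rw [minSmoothness_of_isRCLikeNormedField]
    exact WithTop.coe_le_coe.2 (le_top : (2 : ℕ∞) ≤ ⊤))).eq u v

theorem fderiv_fieldRep_transition {c d : M} {y : Model n} (hy : y ∈ overlap c d)
    {X : VField n M} (hX : SmoothInCharts X) (u : Model n) :
    fderiv ℝ (fieldRep d X) (transition c d y) (fderiv ℝ (transition c d) y u) =
      fderiv ℝ (fderiv ℝ (transition c d)) y u (fieldRep c X y)
        + fderiv ℝ (transition c d) y (fderiv ℝ (fieldRep c X) y u) := by
  have hev : (fun z ↦ fieldRep d X (transition c d z)) =ᶠ[𝓝 y] fun z ↦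
      fderiv ℝ (transition c d) z (fieldRep c X z) := by
    filter_upwards [(isOpen_overlap c d).mem_nhds hy] with z hz
    exact fieldRep_transition hz X
  have hτ := contDiffAt_transition hy
  have h1 : HasFDerivAt (transition c d) (fderiv ℝ (transition c d) y) y :=
    (hτ.differentiableAt (by simp)).hasFDerivAt
  have h2 : HasFDerivAt (fderiv ℝ (transition c d)) (fderiv ℝ (fderiv ℝ (transition c d)) y) y :=
    ((hτ.fderiv_right (m := ∞) (by simp)).differentiableAt (by simp)).hasFDerivAt
  have h3 := (hX.differentiableAt (transition_mem_target hy)).hasFDerivAt.comp y h1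
  have h4 := h2.clm_apply (hX.differentiableAt hy.1).hasFDerivAt
  have h5 := congrArg (fun L ↦ L u) (h3.unique (h4.congr_of_eventuallyEq hev))
  simpa [add_comm] using h5

/-- Among the six second-derivative terms coming from the metric, symmetry of g and of D²τ cancels
four and leaves g(D²τ(u, X), Dτ w), halved twice over. This is exactly the extra term produced by
differentiating the transformed components of X. -/
theorem covLow_transition {c d : M} {y : Model n} (hy : y ∈ overlap c d)
    {X : VField n M} (hX : SmoothInCharts X) (u w : Model n) :
    covLow g c X y u w = covLow g d X (transition c d y) (fderiv ℝ (transition c d) y u)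
      (fderiv ℝ (transition c d) y w) := by
  rw [covLow_apply, covLow_apply, fderiv_fieldRep_transition hy hX, fieldRep_transition hy,
    metricBil_transition g hy, fderiv_metricBil_transition g hy, fderiv_metricBil_transition g hy,
    fderiv_metricBil_transition g hy, fderiv_fderiv_transition_symm hy w (fieldRep c X y),
    fderiv_fderiv_transition_symm hy (fieldRep c X y) u, fderiv_fderiv_transition_symm hy w u,
    metricBil_symm g d _ _ (fderiv ℝ (fderiv ℝ (transition c d)) y u w),
    metricBil_symm g d _ _ (fderiv ℝ (fderiv ℝ (transition c d)) y (fieldRep c X y) w)]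
  rw [map_add, add_apply]
  ring

theorem pd_metricCoord {c : M} {y : Model n} (hy : y ∈ (extChartAt (𝓡 n) c).target)
    (i j k : Fin n) :
    pd i (fun z ↦ metricCoord g c z j k) y = fderiv ℝ (metricBil g c) y
      (EuclideanSpace.single i 1) (EuclideanSpace.single j 1) (EuclideanSpace.single k 1) := by
  rw [pd, ← fderiv_metricBil_apply g hy]
  simp only [metricBil_single]

theorem sum_christoffel_mul_metricCoord {c : M} {y : Model n}
    (hy : y ∈ (extChartAt (𝓡 n) c).target) (i j l : Fin n) :
    ∑ k, christoffel g c k i j y * metricCoord g c y k l =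
      (1 / 2) * (pd i (fun z ↦ metricCoord g c z j l) y + pd j (fun z ↦ metricCoord g c z i l) y
        - pd l (fun z ↦ metricCoord g c z i j) y) := by
  set a : Fin n → ℝ := fun l ↦ (1 / 2) * (pd i (fun z ↦ metricCoord g c z j l) y
    + pd j (fun z ↦ metricCoord g c z i l) y - pd l (fun z ↦ metricCoord g c z i j) y) with ha
  have h1 : ∀ k, christoffel g c k i j y = ((metricCoord g c y)⁻¹ *ᵥ a) k := by
    intro k
    simp only [christoffel, Matrix.mulVec, dotProduct, ha, Finset.mul_sum]
    exact Finset.sum_congr rfl fun l _ ↦ by ring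
  have h2 : (metricCoord g c y *ᵥ ((metricCoord g c y)⁻¹ *ᵥ a)) l = a l := by
    rw [Matrix.mulVec_mulVec, Matrix.mul_nonsing_inv _ (metricCoord_isUnit g hy), Matrix.one_mulVec]
  refine Eq.trans ?_ h2
  simp only [h1]
  conv_rhs => rw [Matrix.mulVec, dotProduct]
  exact Finset.sum_congr rfl fun k _ ↦ by rw [metricCoord_symm g c y l k, mul_comm]

theorem fderiv_metricBil_sum (c : M) (y u v w : Model n) :
    fderiv ℝ (metricBil g c) y u v w = ∑ j, v j * fderiv ℝ (metricBil g c) y u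
      (EuclideanSpace.single j 1) w := by
  conv_lhs => rw [eq_sum_single v]
  simp [sum_apply]

/-- Lowering the index cancels the inverse metric in the Christoffel symbols. This ties the
coordinate definition to `covLow`, so no transformation law for the symbols themselves is required.
-/
theorem sum_covCoord_mul_metricCoord {X : VField n M} (hX : SmoothInCharts X) {c : M}
    {y : Model n} (hy : y ∈ (extChartAt (𝓡 n) c).target) (i l : Fin n) :
    ∑ k, covCoord g c X y i k * metricCoord g c y k l =
      covLow g c X y (EuclideanSpace.single i 1) (EuclideanSpace.single l 1) := by
  have h1 : ∑ k, covCoord g c X y i k * metricCoord g c y k l =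
      ∑ k, pd i (fun z ↦ vecCoord c X z k) y * metricCoord g c y k l +
      ∑ j, vecCoord c X y j * ∑ k, christoffel g c k i j y * metricCoord g c y k l := by
    simp only [covCoord, add_mul, Finset.sum_add_distrib, Finset.mul_sum, Finset.sum_mul]
    congr 1
    rw [Finset.sum_comm]
    exact Finset.sum_congr rfl fun j _ ↦ Finset.sum_congr rfl fun k _ ↦ by ring
  rw [h1, covLow_apply]
  congr 1
  · rw [metricBil_apply]
    simp [pd_vecCoord hX hy, mul_comm]
  · simp only [sum_christoffel_mul_metricCoord g hy, pd_metricCoord g hy]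
    rw [fderiv_metricBil_sum g c y (EuclideanSpace.single i 1) (fieldRep c X y),
      fderiv_metricBil_sum g c y (EuclideanSpace.single l 1) (fieldRep c X y)]
    have h2 : fderiv ℝ (metricBil g c) y (fieldRep c X y) (EuclideanSpace.single i 1)
        (EuclideanSpace.single l 1) = ∑ j, fieldRep c X y j * fderiv ℝ (metricBil g c) y
          (EuclideanSpace.single j 1) (EuclideanSpace.single i 1) (EuclideanSpace.single l 1) := by
      conv_lhs => rw [eq_sum_single (fieldRep c X y)]
      simp [sum_apply]
    rw [h2, ← Finset.sum_add_distrib, ← Finset.sum_sub_distrib, Finset.mul_sum]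
    refine Finset.sum_congr rfl fun j _ ↦ ?_
    rw [fderiv_metricBil_symm g hy (EuclideanSpace.single l 1) (EuclideanSpace.single j 1)]
    change fieldRep c X y j * _ = _
    ring

/-- The endomorphism `u ↦ ∇_u X` in the chart at `c`. -/
def covLin (c : M) (X : VField n M) (y : Model n) : Model n →ₗ[ℝ] Model n :=
  Matrix.toLin (EuclideanSpace.basisFun (Fin n) ℝ).toBasis
    (EuclideanSpace.basisFun (Fin n) ℝ).toBasis (Matrix.of fun k i ↦ covCoord g c X y i k)

theorem covLin_apply (c : M) (X : VField n M) (y u : Model n) (k : Fin n) :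
    covLin g c X y u k = ∑ i, u i * covCoord g c X y i k := by
  simp [covLin, Matrix.toLin_apply, Matrix.mulVec, dotProduct, mul_comm, Pi.single_apply]

theorem metricBil_covLin {X : VField n M} (hX : SmoothInCharts X) {c : M} {y : Model n}
    (hy : y ∈ (extChartAt (𝓡 n) c).target) (u w : Model n) :
    metricBil g c y (covLin g c X y u) w = covLow g c X y u w := by
  have h2 : covLow g c X y u w = ∑ i, ∑ l, u i * w l * covLow g c X y
      (EuclideanSpace.single i 1) (EuclideanSpace.single l 1) := by
    conv_lhs => rw [eq_sum_single u, eq_sum_single w]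
    simp only [map_sum, map_smul, sum_apply, smul_apply, smul_eq_mul, Finset.mul_sum]
    rw [Finset.sum_comm]
    exact Finset.sum_congr rfl fun i _ ↦ Finset.sum_congr rfl fun l _ ↦ by ring
  rw [h2, metricBil_apply]
  simp only [← sum_covCoord_mul_metricCoord g hX hy, covLin_apply, Finset.mul_sum, Finset.sum_mul]
  calc _ = ∑ k, ∑ i, ∑ l, metricCoord g c y k l * (u i * covCoord g c X y i k) * w l :=
        Finset.sum_congr rfl fun k _ ↦ Finset.sum_comm
    _ = ∑ i, ∑ k, ∑ l, metricCoord g c y k l * (u i * covCoord g c X y i k) * w l :=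
        Finset.sum_comm
    _ = _ := Finset.sum_congr rfl fun i _ ↦ by
        rw [Finset.sum_comm]
        exact Finset.sum_congr rfl fun l _ ↦ Finset.sum_congr rfl fun k _ ↦ by ring

/-- The lowered form is invariant and the metric is nondegenerate, so the endomorphism itself is
intertwined by the derivative of the transition map. -/
theorem covLin_transition {c d : M} {y : Model n} (hy : y ∈ overlap c d)
    {X : VField n M} (hX : SmoothInCharts X) (u : Model n) :
    covLin g d X (transition c d y) (fderiv ℝ (transition c d) y u) =
      fderiv ℝ (transition c d) y (covLin g c X y u) := by
  refine metricBil_nondegenerate g (transition_mem_target hy) fun w ↦ ?_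
  obtain ⟨w, rfl⟩ := (fderiv_transition_bijective hy).2 w
  rw [metricBil_covLin g hX (transition_mem_target hy), ← covLow_transition g hy hX,
    ← metricBil_transition g hy, metricBil_covLin g hX hy.1]

theorem trace_covLin (c : M) (X : VField n M) (y : Model n) :
    LinearMap.trace ℝ _ (covLin g c X y) = ∑ i, covCoord g c X y i i := by
  rw [covLin, Matrix.trace_toLin_eq]
  rfl

theorem trace_covLin_comp (c : M) (X Y : VField n M) (y : Model n) :
    LinearMap.trace ℝ _ (covLin g c X y ∘ₗ covLin g c Y y) =
      ∑ i, ∑ j, covCoord g c X y i j * covCoord g c Y y j i := by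
  rw [covLin, covLin, ← Matrix.toLin_mul, Matrix.trace_toLin_eq]
  simp only [Matrix.trace, Matrix.diag, Matrix.mul_apply, Matrix.of_apply]
  rw [Finset.sum_comm]

/-- A single `e` serves all fields, so traces of compositions ∇X ∘ ∇Y are invariant as well as
traces of ∇X. -/
theorem covLin_transition_conj {c d : M} {y : Model n} (hy : y ∈ overlap c d) :
    ∃ e : Model n ≃ₗ[ℝ] Model n, ∀ X : VField n M, SmoothInCharts X →
      covLin g d X (transition c d y) = e.conj (covLin g c X y) := by
  set e : Model n ≃ₗ[ℝ] Model n := LinearEquiv.ofBijective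
    (fderiv ℝ (transition c d) y).toLinearMap (fderiv_transition_bijective hy) with he
  refine ⟨e, fun X hX ↦ ?_⟩
  ext1 w
  obtain ⟨u, rfl⟩ := (fderiv_transition_bijective hy).2 w
  rw [covLin_transition g hy hX, LinearEquiv.conj_apply_apply]
  have h : e.symm (fderiv ℝ (transition c d) y u) = u := e.symm_apply_apply u
  rw [h]
  rfl

theorem sum_covCoord_transition {c d : M} {y : Model n} (hy : y ∈ overlap c d)
    {X : VField n M} (hX : SmoothInCharts X) :
    ∑ i, covCoord g d X (transition c d y) i i = ∑ i, covCoord g c X y i i := by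
  obtain ⟨e, he⟩ := covLin_transition_conj g hy
  rw [← trace_covLin, ← trace_covLin, he X hX, LinearMap.trace_conj']

theorem sum_covCoord_mul_covCoord_transition {c d : M} {y : Model n} (hy : y ∈ overlap c d)
    {X Y : VField n M} (hX : SmoothInCharts X) (hY : SmoothInCharts Y) :
    ∑ i, ∑ j, covCoord g d X (transition c d y) i j * covCoord g d Y (transition c d y) j i =
      ∑ i, ∑ j, covCoord g c X y i j * covCoord g c Y y j i := by
  obtain ⟨e, he⟩ := covLin_transition_conj g hy
  rw [← trace_covLin_comp, ← trace_covLin_comp, he X hX, he Y hY, ← LinearEquiv.conj_comp,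
    LinearMap.trace_conj']

end Covariant

/-! ### Divergence, traces, ∇_V Y and gradients as global objects. -/

section Global

open Set Filter Topology

variable {n : ℕ} {M : Type*} [TopologicalSpace M] [ChartedSpace (Model n) M]

/-- The function `f` is smooth in each chart. -/
def SmoothFunInCharts (f : M → ℝ) : Prop :=
  ∀ c, ContDiffOn ℝ ∞ (funRep c f) (extChartAt (𝓡 n) c).target

/-- The representative `F c` must compute `f` on the whole domain of the chart at `c`. A formula in
the preferred chart of the moving point would not do, since that chart may jump; this is why chart
invariance is needed. -/
theorem continuous_of_chart {f : M → ℝ} (F : M → Model n → ℝ)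
    (hF : ∀ c, ContinuousOn (F c) (extChartAt (𝓡 n) c).target)
    (h : ∀ c, ∀ p ∈ (extChartAt (𝓡 n) c).source, f p = F c (extChartAt (𝓡 n) c p)) :
    Continuous f := by
  refine continuous_iff_continuousAt.2 fun c ↦ ?_
  have h1 : ContinuousAt (F c) (extChartAt (𝓡 n) c c) :=
    (hF c).continuousAt ((isOpen_chartTarget c).mem_nhds (mem_extChartAt_target c))
  refine (h1.comp (continuousAt_extChartAt c)).congr ?_
  filter_upwards [extChartAt_source_mem_nhds (I := 𝓡 n) c] with p hp
  exact (h c p hp).symm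

theorem funRep_chart {c p : M} (hp : p ∈ (extChartAt (𝓡 n) c).source) (f : M → ℝ) :
    funRep c f (extChartAt (𝓡 n) c p) = f p := by
  rw [funRep, (extChartAt (𝓡 n) c).left_inv hp]

theorem SmoothFunInCharts.continuous {f : M → ℝ} (hf : SmoothFunInCharts (n := n) f) :
    Continuous f :=
  continuous_of_chart (fun c ↦ funRep c f) (fun c ↦ (hf c).continuousOn)
    fun _ _ hp ↦ (funRep_chart hp f).symm

theorem SmoothFunInCharts.differentiableAt {f : M → ℝ} (hf : SmoothFunInCharts (n := n) f) {c : M}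
    {y : Model n} (hy : y ∈ (extChartAt (𝓡 n) c).target) :
    DifferentiableAt ℝ (funRep c f) y :=
  ((hf c).contDiffAt ((isOpen_chartTarget c).mem_nhds hy)).differentiableAt (by simp)

theorem fieldRep_smul (c : M) (f : M → ℝ) (X : VField n M) (y : Model n) :
    fieldRep c (fun p ↦ f p • X p) y = funRep c f y • fieldRep c X y :=
  map_smul (mvfderiv (𝓡 n) (extChartAt (𝓡 n) c) _) _ _

theorem fieldRep_sum {ι : Type*} (s : Finset ι) (c : M) (X : ι → VField n M) (y : Model n) :
    fieldRep c (fun p ↦ ∑ i ∈ s, X i p) y = ∑ i ∈ s, fieldRep c (X i) y :=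
  map_sum (mvfderiv (𝓡 n) (extChartAt (𝓡 n) c) _) _ _

theorem SmoothInCharts.smul {f : M → ℝ} (hf : SmoothFunInCharts (n := n) f) {X : VField n M}
    (hX : SmoothInCharts X) : SmoothInCharts (fun p ↦ f p • X p) :=
  fun c ↦ ((hf c).smul (hX c)).congr fun y _ ↦ fieldRep_smul c f X y

theorem SmoothInCharts.coord {X : VField n M} (hX : SmoothInCharts X) (c : M) (k : Fin n) :
    ContDiffOn ℝ ∞ (fun y ↦ vecCoord c X y k) (extChartAt (𝓡 n) c).target :=
  (EuclideanSpace.proj k : Model n →L[ℝ] ℝ).contDiff.comp_contDiffOn (hX c)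

variable [IsManifold (𝓡 n) ∞ M] (g : Metric n M)

theorem contDiffOn_covCoord {X : VField n M} (hX : SmoothInCharts X) (c : M) (i k : Fin n) :
    ContDiffOn ℝ ∞ (fun y ↦ covCoord g c X y i k) (extChartAt (𝓡 n) c).target := by
  unfold covCoord
  exact (contDiffOn_pd (isOpen_chartTarget c) (hX.coord c k) i).add
    (ContDiffOn.sum fun j _ ↦ (contDiffOn_christoffel g c k i j).mul (hX.coord c j))

theorem divergence_eq_chart {X : VField n M} (hX : SmoothInCharts X) {c p : M}
    (hp : p ∈ (extChartAt (𝓡 n) c).source) :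
    divergence g X p = ∑ i, covCoord g c X (extChartAt (𝓡 n) c p) i i := by
  rw [← sum_covCoord_transition g (chart_mem_overlap hp (mem_extChartAt_source p)) hX,
    transition_chart hp]
  rfl

/-- The trace of `∇X ∘ ∇Y`. -/
def covTrace (X Y : VField n M) (p : M) : ℝ :=
  ∑ i, ∑ j, covCoord g p X (base p) i j * covCoord g p Y (base p) j i

theorem covTrace_eq_chart {X Y : VField n M} (hX : SmoothInCharts X) (hY : SmoothInCharts Y)
    {c p : M} (hp : p ∈ (extChartAt (𝓡 n) c).source) :
    covTrace g X Y p = ∑ i, ∑ j, covCoord g c X (extChartAt (𝓡 n) c p) i j *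
      covCoord g c Y (extChartAt (𝓡 n) c p) j i := by
  rw [← sum_covCoord_mul_covCoord_transition g
    (chart_mem_overlap hp (mem_extChartAt_source p)) hX hY, transition_chart hp]
  rfl

theorem inner_eq_chart (X Y : VField n M) {c p : M} (hp : p ∈ (extChartAt (𝓡 n) c).source) :
    g.inner p (X p) (Y p) = metricBil g c (extChartAt (𝓡 n) c p)
      (fieldRep c X (extChartAt (𝓡 n) c p)) (fieldRep c Y (extChartAt (𝓡 n) c p)) := by
  rw [fieldRep_chart hp, fieldRep_chart hp, metricBil_chart g hp]

theorem funRep_inner {c : M} {y : Model n} (hy : y ∈ (extChartAt (𝓡 n) c).target)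
    (X Y : VField n M) :
    funRep c (fun p ↦ g.inner p (X p) (Y p)) y =
      metricBil g c y (fieldRep c X y) (fieldRep c Y y) := by
  have := inner_eq_chart g X Y ((extChartAt (𝓡 n) c).map_target hy)
  rwa [(extChartAt (𝓡 n) c).right_inv hy] at this

theorem smoothFun_inner {X Y : VField n M} (hX : SmoothInCharts X) (hY : SmoothInCharts Y) :
    SmoothFunInCharts (n := n) (fun p ↦ g.inner p (X p) (Y p)) := fun c ↦
  (((contDiffOn_metricBil g c).clm_apply (hX c)).clm_apply (hY c)).congr
    fun _ hy ↦ funRep_inner g hy X Y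

theorem continuous_divergence {X : VField n M} (hX : SmoothInCharts X) :
    Continuous (divergence g X) :=
  continuous_of_chart (fun c y ↦ ∑ i, covCoord g c X y i i)
    (fun c ↦ continuousOn_finsetSum _ fun i _ ↦ (contDiffOn_covCoord g hX c i i).continuousOn)
    fun _ _ hp ↦ divergence_eq_chart g hX hp

theorem continuous_covTrace {X Y : VField n M} (hX : SmoothInCharts X) (hY : SmoothInCharts Y) :
    Continuous (covTrace g X Y) :=
  continuous_of_chart (fun c y ↦ ∑ i, ∑ j, covCoord g c X y i j * covCoord g c Y y j i)
    (fun c ↦ continuousOn_finsetSum _ fun i _ ↦ continuousOn_finsetSum _ fun j _ ↦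
      (contDiffOn_covCoord g hX c i j).continuousOn.mul
        (contDiffOn_covCoord g hY c j i).continuousOn)
    fun _ _ hp ↦ covTrace_eq_chart g hX hY hp

/-- The vector field `∇_V Y`. -/
def covField (V Y : VField n M) : VField n M := fun p ↦
  (mvfderiv_chart_surjective (mem_extChartAt_source p)
    (covLin g p Y (base p) (fieldRep p V (base p)))).choose

theorem mvfderiv_covField (V Y : VField n M) (p : M) :
    mvfderiv (𝓡 n) (extChartAt (𝓡 n) p) p (covField g V Y p) =
      covLin g p Y (base p) (fieldRep p V (base p)) :=
  (mvfderiv_chart_surjective (mem_extChartAt_source p)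
    (covLin g p Y (base p) (fieldRep p V (base p)))).choose_spec

/-- `covField` is fixed at each point by its value in the preferred chart there; `covLin_transition`
carries the formula to every other chart. -/
theorem fieldRep_covField (V : VField n M) {Y : VField n M} (hY : SmoothInCharts Y) {c : M}
    {y : Model n} (hy : y ∈ (extChartAt (𝓡 n) c).target) :
    fieldRep c (covField g V Y) y = covLin g c Y y (fieldRep c V y) := by
  obtain ⟨p, hp, rfl⟩ : ∃ p ∈ (extChartAt (𝓡 n) c).source, extChartAt (𝓡 n) c p = y :=
    ⟨_, (extChartAt (𝓡 n) c).map_target hy, (extChartAt (𝓡 n) c).right_inv hy⟩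
  have hov : (base p : Model n) ∈ overlap p c := chart_mem_overlap (mem_extChartAt_source p) hp
  have hτ : transition p c (base p : Model n) = extChartAt (𝓡 n) c p :=
    transition_chart (mem_extChartAt_source p)
  have h1 : fieldRep p (covField g V Y) (base p) =
      covLin g p Y (base p) (fieldRep p V (base p)) :=
    (fieldRep_chart (mem_extChartAt_source p) _).trans (mvfderiv_covField g V Y p)
  rw [← hτ, fieldRep_transition hov, fieldRep_transition hov, h1, covLin_transition g hov hY]

theorem vecCoord_covField (V : VField n M) {Y : VField n M} (hY : SmoothInCharts Y) {c : M}
    {y : Model n} (hy : y ∈ (extChartAt (𝓡 n) c).target) (k : Fin n) :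
    vecCoord c (covField g V Y) y k = ∑ j, vecCoord c V y j * covCoord g c Y y j k := by
  change fieldRep c (covField g V Y) y k = _
  rw [fieldRep_covField g V hY hy, covLin_apply]
  rfl

theorem SmoothInCharts.covField {V Y : VField n M} (hV : SmoothInCharts V)
    (hY : SmoothInCharts Y) : SmoothInCharts (covField g V Y) := fun c ↦ by
  refine contDiffOn_euclidean.2 fun k ↦ ContDiffOn.congr ?_
    fun y hy ↦ vecCoord_covField g V hY hy k
  exact ContDiffOn.sum fun j _ ↦ (hV.coord c j).mul (contDiffOn_covCoord g hY c j k)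

theorem inner_grad (h : M → ℝ) (p : M) (v : TangentSpace (𝓡 n) p) :
    g.inner p (grad g h p) v = mvfderiv (𝓡 n) h p v :=
  LinearMap.BilinForm.apply_toDual_symm_apply (hB := metricForm_nondegenerate g p)
    (mvfderiv (𝓡 n) h p : TangentSpace (𝓡 n) p →ₗ[ℝ] ℝ) v

theorem mvfderiv_eq_fderiv_funRep {h : M → ℝ} (hh : ContMDiff (𝓡 n) 𝓘(ℝ, ℝ) ∞ h) {c : M}
    {y : Model n} (hy : y ∈ (extChartAt (𝓡 n) c).target)
    (v : TangentSpace (𝓡 n) ((extChartAt (𝓡 n) c).symm y)) :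
    mvfderiv (𝓡 n) h ((extChartAt (𝓡 n) c).symm y) v = fderiv ℝ (funRep c h) y
      (mvfderiv (𝓡 n) (extChartAt (𝓡 n) c) ((extChartAt (𝓡 n) c).symm y) v) := by
  have h1 := mfderiv_comp y (hh.mdifferentiable (by simp) _) (mdifferentiableAt_chart_symm hy)
  have h' : mfderiv 𝓘(ℝ, Model n) 𝓘(ℝ, ℝ) (h ∘ (extChartAt (𝓡 n) c).symm) y =
      fderiv ℝ (funRep c h) y := mfderiv_eq_fderiv
  have h2 := congrArg (fun L ↦ L (mvfderiv (𝓡 n) (extChartAt (𝓡 n) c)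
    ((extChartAt (𝓡 n) c).symm y) v)) (h'.symm.trans h1)
  refine Eq.trans ?_ h2.symm
  have h3 := mfderiv_symm_comp hy v
  exact congrArg (mvfderiv (𝓡 n) h ((extChartAt (𝓡 n) c).symm y)) h3.symm

theorem metricBil_grad {h : M → ℝ} (hh : ContMDiff (𝓡 n) 𝓘(ℝ, ℝ) ∞ h) {c : M}
    {y : Model n} (hy : y ∈ (extChartAt (𝓡 n) c).target) (w : Model n) :
    metricBil g c y (fieldRep c (grad g h) y) w = fderiv ℝ (funRep c h) y w := by
  have hp := (extChartAt (𝓡 n) c).map_target hy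
  obtain ⟨w, rfl⟩ := mvfderiv_chart_surjective hp w
  rw [← mvfderiv_eq_fderiv_funRep hh hy, ← inner_grad g]
  have := metricBil_chart g hp (grad g h _) w
  rwa [(extChartAt (𝓡 n) c).right_inv hy] at this

theorem diffCoord_eq {h : M → ℝ} (hh : ContMDiff (𝓡 n) 𝓘(ℝ, ℝ) ∞ h) {c : M}
    {y : Model n} (hy : y ∈ (extChartAt (𝓡 n) c).target) (l : Fin n) :
    diffCoord c h y l = ∑ k, vecCoord c (grad g h) y k * metricCoord g c y k l := by
  change fderiv ℝ (funRep c h) y (EuclideanSpace.single l 1) = _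
  rw [← metricBil_grad g hh hy, metricBil_apply]
  simp [mul_comm, vecCoord, fieldRep]

theorem vecCoord_grad {h : M → ℝ} (hh : ContMDiff (𝓡 n) 𝓘(ℝ, ℝ) ∞ h) {c : M}
    {y : Model n} (hy : y ∈ (extChartAt (𝓡 n) c).target) (k : Fin n) :
    vecCoord c (grad g h) y k = ∑ l, (metricCoord g c y)⁻¹ k l * diffCoord c h y l := by
  have h1 : diffCoord c h y = metricCoord g c y *ᵥ vecCoord c (grad g h) y := by
    ext l
    rw [diffCoord_eq g hh hy, Matrix.mulVec, dotProduct]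
    exact Finset.sum_congr rfl fun k _ ↦ by rw [mul_comm, metricCoord_symm]
  change _ = ((metricCoord g c y)⁻¹ *ᵥ diffCoord c h y) k
  rw [h1, Matrix.mulVec_mulVec, Matrix.nonsing_inv_mul _ (metricCoord_isUnit g hy),
    Matrix.one_mulVec]

theorem smoothInCharts_grad {h : M → ℝ} (hh : ContMDiff (𝓡 n) 𝓘(ℝ, ℝ) ∞ h) :
    SmoothInCharts (grad g h) := fun c ↦ by
  refine contDiffOn_euclidean.2 fun k ↦ ContDiffOn.congr ?_ fun y hy ↦ vecCoord_grad g hh hy k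
  exact ContDiffOn.sum fun l _ ↦ (contDiffOn_metricCoord_inv g c k l).mul
    (contDiffOn_pd (isOpen_chartTarget c) (contDiffOn_funRep hh c) l)

end Global

/-! ### Pointwise identities: Lie derivative, Hessian, divergences, and the Ricci commutation. -/

section Pointwise

open Set Filter Topology

variable {n : ℕ}

theorem pd_comm {f : Model n → ℝ} {y : Model n} (hf : ContDiffAt ℝ ∞ f y) (i j : Fin n) :
    pd i (pd j f) y = pd j (pd i f) y := by
  have h2 : DifferentiableAt ℝ (fderiv ℝ f) y :=
    (hf.fderiv_right (m := ∞) (by simp)).differentiableAt (by simp)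
  have key : ∀ i j : Fin n, pd i (pd j f) y =
      fderiv ℝ (fderiv ℝ f) y (EuclideanSpace.single i 1) (EuclideanSpace.single j 1) := by
    intro i j
    have h3 := h2.hasFDerivAt.clm_apply (hasFDerivAt_const (EuclideanSpace.single j (1 : ℝ)) y)
    change fderiv ℝ (fun z ↦ fderiv ℝ f z (EuclideanSpace.single j 1)) y _ = _
    rw [h3.fderiv]
    simp
  rw [key, key]
  exact (hf.isSymmSndFDerivAt (by
    rw [minSmoothness_of_isRCLikeNormedField]
    exact WithTop.coe_le_coe.2 (le_top : (2 : ℕ∞) ≤ ⊤))).eq _ _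

theorem pd_congr {f f' : Model n → ℝ} {y : Model n} (h : f =ᶠ[𝓝 y] f') (i : Fin n) :
    pd i f y = pd i f' y := by
  rw [pd, pd, h.fderiv_eq]

theorem pd_add {f f' : Model n → ℝ} {y : Model n} (hf : DifferentiableAt ℝ f y)
    (hf' : DifferentiableAt ℝ f' y) (i : Fin n) :
    pd i (fun z ↦ f z + f' z) y = pd i f y + pd i f' y := by
  simp [pd, fderiv_fun_add hf hf']

theorem pd_mul {f f' : Model n → ℝ} {y : Model n} (hf : DifferentiableAt ℝ f y)
    (hf' : DifferentiableAt ℝ f' y) (i : Fin n) :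
    pd i (fun z ↦ f z * f' z) y = pd i f y * f' y + f y * pd i f' y := by
  simp [pd, fderiv_fun_mul hf hf']
  ring

theorem pd_sum {ι : Type*} {s : Finset ι} {f : ι → Model n → ℝ} {y : Model n}
    (hf : ∀ a ∈ s, DifferentiableAt ℝ (f a) y) (i : Fin n) :
    pd i (fun z ↦ ∑ a ∈ s, f a z) y = ∑ a ∈ s, pd i (f a) y := by
  simp [pd, fderiv_fun_sum hf, sum_apply]

/-- The algebraic part of the commutation formula `∇ᵢ∇ⱼ Yⁱ = ∇ⱼ∇ᵢ Yⁱ + R_{jk} Yᵏ`. -/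
theorem sum_commutation {ι : Type*} [Fintype ι] (a b N : ι → ι → ℝ) (V Y : ι → ℝ)
    (Γ dd : ι → ι → ι → ℝ) (dΓ : ι → ι → ι → ι → ℝ)
    (hN : ∀ j i, N j i = b j i + ∑ k, Γ i j k * Y k)
    (hΓ : ∀ k i j, Γ k i j = Γ k j i) (hdd : ∀ i j k, dd i j k = dd j i k)
    (hdiv : ∀ j, ∑ i, (dd j i i + ∑ k, (dΓ j i i k * Y k + Γ i i k * b j k)) = 0) :
    ∑ i, (∑ j, (a i j * N j i
        + V j * (dd i j i + ∑ k, (dΓ i i j k * Y k + Γ i j k * b i k)))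
        + ∑ l, Γ i i l * ∑ j, V j * N j l) =
      ∑ i, ∑ j, (a i j + ∑ l, Γ j i l * V l) * N j i
        + ∑ j, ∑ k, (∑ i, (dΓ i i j k - dΓ j i i k
          + ∑ l, (Γ i i l * Γ l j k - Γ i j l * Γ l i k))) * V j * Y k := by
  -- Both sides are brought to the form Σ a N + Σ V_j (…), which reduces the claim to one identity
  -- for each `j`.
  have hL : ∑ i, (∑ j, (a i j * N j i
        + V j * (dd i j i + ∑ k, (dΓ i i j k * Y k + Γ i j k * b i k)))
        + ∑ l, Γ i i l * ∑ j, V j * N j l) =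
      ∑ i, ∑ j, a i j * N j i + ∑ j, V j * (∑ i, (dd i j i
        + ∑ k, (dΓ i i j k * Y k + Γ i j k * b i k)) + ∑ i, ∑ l, Γ i i l * N j l) := by
    simp only [Finset.sum_add_distrib, mul_add]
    rw [add_assoc]
    congr 1
    congr 1
    · congr 1
      · rw [Finset.sum_comm]
        simp only [Finset.mul_sum]
      · simp only [← Finset.sum_add_distrib, ← mul_add]
        rw [Finset.sum_comm]
        simp only [Finset.mul_sum]
    · calc _ = ∑ i, ∑ j, ∑ l, Γ i i l * (V j * N j l) := by
            refine Finset.sum_congr rfl fun i _ ↦ ?_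
            simp only [Finset.mul_sum]
            exact Finset.sum_comm
        _ = _ := by
            rw [Finset.sum_comm]
            simp only [Finset.mul_sum]
            exact Finset.sum_congr rfl fun j _ ↦ Finset.sum_congr rfl fun i _ ↦
              Finset.sum_congr rfl fun l _ ↦ by ring
  have hR : ∑ i, ∑ j, (a i j + ∑ l, Γ j i l * V l) * N j i
        + ∑ j, ∑ k, (∑ i, (dΓ i i j k - dΓ j i i k
          + ∑ l, (Γ i i l * Γ l j k - Γ i j l * Γ l i k))) * V j * Y k =
      ∑ i, ∑ j, a i j * N j i + ∑ j, V j * (∑ i, ∑ l, Γ l i j * N l i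
        + ∑ i, ∑ k, (dΓ i i j k - dΓ j i i k
          + ∑ l, (Γ i i l * Γ l j k - Γ i j l * Γ l i k)) * Y k) := by
    simp only [add_mul (a _ _), Finset.sum_add_distrib (f := fun _ ↦ a _ _ * _), mul_add (V _),
      Finset.sum_add_distrib (f := fun _ ↦ V _ * _)]
    rw [Finset.sum_add_distrib, add_assoc]
    congr 1
    congr 1
    · calc _ = ∑ i, ∑ l, ∑ j, Γ j i l * V l * N j i := by
            refine Finset.sum_congr rfl fun i _ ↦ ?_
            simp only [Finset.sum_mul]
            exact Finset.sum_comm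
        _ = _ := by
            rw [Finset.sum_comm]
            simp only [Finset.mul_sum]
            exact Finset.sum_congr rfl fun j _ ↦ Finset.sum_congr rfl fun i _ ↦
              Finset.sum_congr rfl fun l _ ↦ by ring
    · refine Finset.sum_congr rfl fun j _ ↦ ?_
      rw [Finset.sum_comm, Finset.mul_sum]
      refine Finset.sum_congr rfl fun k _ ↦ ?_
      rw [← Finset.sum_mul]
      ring
  rw [hL, hR]
  congr 1
  refine Finset.sum_congr rfl fun j _ ↦ ?_
  congr 1
  -- After exchanging the partial derivatives, the second-order term is ∂_j of the coordinate
  -- divergence, which is eliminated by differentiating div Y = 0.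
  have e1 : ∑ i, dd i j i = - ∑ i, ∑ k, (dΓ j i i k * Y k + Γ i i k * b j k) := by
    have := hdiv j
    rw [Finset.sum_add_distrib] at this
    simp only [hdd _ j]
    linarith
  -- Expanding ∇Y in the products Γ · ∇Y produces the two quadratic terms of the Ricci tensor, here
  -- and in `e3`; the Γ · ∂Y parts cancel.
  have e2 : ∑ i, ∑ l, Γ i i l * N j l =
      ∑ i, ∑ k, Γ i i k * b j k + ∑ i, ∑ k, (∑ l, Γ i i l * Γ l j k) * Y k := by
    simp only [hN, mul_add, Finset.sum_add_distrib, Finset.sum_mul, Finset.mul_sum]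
    congr 1
    refine Finset.sum_congr rfl fun i _ ↦ ?_
    rw [Finset.sum_comm]
    exact Finset.sum_congr rfl fun k _ ↦ Finset.sum_congr rfl fun l _ ↦ by ring
  have e3 : ∑ i, ∑ l, Γ l i j * N l i =
      ∑ i, ∑ k, Γ i j k * b i k + ∑ i, ∑ k, (∑ l, Γ i j l * Γ l i k) * Y k := by
    rw [Finset.sum_comm]
    simp only [hN, mul_add, Finset.sum_add_distrib, Finset.sum_mul, Finset.mul_sum]
    congr 1
    · exact Finset.sum_congr rfl fun i _ ↦ Finset.sum_congr rfl fun l _ ↦ by rw [hΓ]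
    · refine Finset.sum_congr rfl fun i _ ↦ ?_
      rw [Finset.sum_comm]
      exact Finset.sum_congr rfl fun k _ ↦ Finset.sum_congr rfl fun l _ ↦ by rw [hΓ i]; ring
  have e4 : ∑ i, ∑ k, (dΓ i i j k - dΓ j i i k
          + ∑ l, (Γ i i l * Γ l j k - Γ i j l * Γ l i k)) * Y k =
      ∑ i, ∑ k, dΓ i i j k * Y k - ∑ i, ∑ k, dΓ j i i k * Y k
        + (∑ i, ∑ k, (∑ l, Γ i i l * Γ l j k) * Y k
          - ∑ i, ∑ k, (∑ l, Γ i j l * Γ l i k) * Y k) := by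
    simp only [← Finset.sum_sub_distrib, ← Finset.sum_add_distrib]
    refine Finset.sum_congr rfl fun i _ ↦ Finset.sum_congr rfl fun k _ ↦ ?_
    rw [Finset.sum_sub_distrib]
    ring
  rw [Finset.sum_add_distrib, e1, e2, e3, e4]
  simp only [Finset.sum_add_distrib]
  ring

variable {M : Type*} [TopologicalSpace M] [ChartedSpace (Model n) M]
  [IsManifold (𝓡 n) ∞ M] (g : Metric n M)

theorem christoffel_symm (c : M) (k i j : Fin n) (y : Model n) :
    christoffel g c k i j y = christoffel g c k j i y := by
  unfold christoffel
  congr 1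
  refine Finset.sum_congr rfl fun l _ ↦ ?_
  have : (fun z ↦ metricCoord g c z i j) = fun z ↦ metricCoord g c z j i :=
    funext fun z ↦ metricCoord_symm g c z i j
  rw [this]
  ring

/-- This is (𝓛_X g)_{ij} = ∇_i X_j + ∇_j X_i: symmetrizing `covLow` cancels the two metric
derivatives of opposite sign and leaves the derivative of g along X. -/
theorem lieCoord_eq {X : VField n M} (hX : SmoothInCharts X) {c : M} {y : Model n}
    (hy : y ∈ (extChartAt (𝓡 n) c).target) (i j : Fin n) :
    lieCoord g c X y i j = ∑ k, covCoord g c X y i k * metricCoord g c y k j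
      + ∑ k, covCoord g c X y j k * metricCoord g c y k i := by
  rw [sum_covCoord_mul_metricCoord g hX hy, sum_covCoord_mul_metricCoord g hX hy, covLow_apply,
    covLow_apply, lieCoord]
  simp only [Matrix.of_apply, Finset.sum_add_distrib, pd_metricCoord g hy, pd_vecCoord hX hy]
  have h1 : ∑ k, vecCoord c X y k * fderiv ℝ (metricBil g c) y (EuclideanSpace.single k 1)
      (EuclideanSpace.single i 1) (EuclideanSpace.single j 1) =
      fderiv ℝ (metricBil g c) y (fieldRep c X y) (EuclideanSpace.single i 1)
        (EuclideanSpace.single j 1) := by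
    conv_rhs => rw [eq_sum_single (fieldRep c X y)]
    simp [sum_apply, vecCoord, fieldRep]
  have h2 : ∀ i j, metricBil g c y (fderiv ℝ (fieldRep c X) y (EuclideanSpace.single i 1))
      (EuclideanSpace.single j 1) = ∑ k, metricCoord g c y k j *
        fderiv ℝ (fieldRep c X) y (EuclideanSpace.single i 1) k := by
    intro i j
    rw [metricBil_apply]
    simp
  rw [h1, h2, h2, fderiv_metricBil_symm g hy _ (EuclideanSpace.single j 1)]
  simp only [metricCoord_symm g c y i]
  ring

/-- Metric compatibility: differentiating ∂_l h = g(∇h, ∂_l) and subtracting the Christoffel term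
leaves precisely `covLow` of the gradient. -/
theorem hessCoord_eq {h : M → ℝ} (hh : ContMDiff (𝓡 n) 𝓘(ℝ, ℝ) ∞ h) {c : M} {y : Model n}
    (hy : y ∈ (extChartAt (𝓡 n) c).target) (i l : Fin n) :
    hessCoord g c h y i l = ∑ k, covCoord g c (grad g h) y i k * metricCoord g c y k l := by
  have hV := smoothInCharts_grad g hh
  rw [sum_covCoord_mul_metricCoord g hV hy, covLow_apply, hessCoord, Matrix.of_apply]
  have h1 : pd i (fun z ↦ diffCoord c h z l) y =
      metricBil g c y (fderiv ℝ (fieldRep c (grad g h)) y (EuclideanSpace.single i 1))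
        (EuclideanSpace.single l 1) + fderiv ℝ (metricBil g c) y (EuclideanSpace.single i 1)
          (fieldRep c (grad g h) y) (EuclideanSpace.single l 1) := by
    have hev : (fun z ↦ diffCoord c h z l) =ᶠ[𝓝 y] fun z ↦
        metricBil g c z (fieldRep c (grad g h) z) (EuclideanSpace.single l 1) := by
      filter_upwards [(isOpen_chartTarget c).mem_nhds hy] with z hz
      exact (metricBil_grad g hh hz _).symm
    rw [pd_congr hev, pd]
    have h2 := ((differentiableAt_metricBil g hy).hasFDerivAt.clm_apply
      (hV.differentiableAt hy).hasFDerivAt).clm_apply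
        (hasFDerivAt_const (EuclideanSpace.single l (1 : ℝ)) y)
    rw [h2.fderiv]
    simp
  have h3 : ∑ k, christoffel g c k i l y * diffCoord c h y k = (1 / 2) *
      (fderiv ℝ (metricBil g c) y (EuclideanSpace.single i 1)
          (fieldRep c (grad g h) y) (EuclideanSpace.single l 1)
        + fderiv ℝ (metricBil g c) y (EuclideanSpace.single l 1)
          (fieldRep c (grad g h) y) (EuclideanSpace.single i 1)
        - fderiv ℝ (metricBil g c) y (fieldRep c (grad g h) y)
          (EuclideanSpace.single i 1) (EuclideanSpace.single l 1)) := by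
    have h4 : ∑ k, christoffel g c k i l y * diffCoord c h y k =
        ∑ s, vecCoord c (grad g h) y s *
          ∑ k, christoffel g c k i l y * metricCoord g c y k s := by
      simp only [diffCoord_eq g hh hy, Finset.mul_sum]
      rw [Finset.sum_comm]
      exact Finset.sum_congr rfl fun s _ ↦ Finset.sum_congr rfl fun k _ ↦ by
        rw [metricCoord_symm g c y s k]; ring
    rw [h4]
    simp only [sum_christoffel_mul_metricCoord g hy, pd_metricCoord g hy]
    rw [fderiv_metricBil_sum g c y (EuclideanSpace.single i 1) (fieldRep c (grad g h) y),
      fderiv_metricBil_sum g c y (EuclideanSpace.single l 1) (fieldRep c (grad g h) y)]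
    have h2 : fderiv ℝ (metricBil g c) y (fieldRep c (grad g h) y) (EuclideanSpace.single i 1)
        (EuclideanSpace.single l 1) = ∑ j, fieldRep c (grad g h) y j *
          fderiv ℝ (metricBil g c) y (EuclideanSpace.single j 1) (EuclideanSpace.single i 1)
            (EuclideanSpace.single l 1) := by
      conv_lhs => rw [eq_sum_single (fieldRep c (grad g h) y)]
      simp [sum_apply]
    rw [h2, ← Finset.sum_add_distrib, ← Finset.sum_sub_distrib, Finset.mul_sum]
    refine Finset.sum_congr rfl fun j _ ↦ ?_
    rw [fderiv_metricBil_symm g hy (EuclideanSpace.single l 1) (EuclideanSpace.single j 1),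
      fderiv_metricBil_symm g hy (EuclideanSpace.single i 1) (EuclideanSpace.single j 1)]
    change fieldRep c (grad g h) y j * _ = _
    ring
  rw [h1, h3]
  ring

theorem hessCoord_symm {h : M → ℝ} (hh : ContMDiff (𝓡 n) 𝓘(ℝ, ℝ) ∞ h) {c : M} {y : Model n}
    (hy : y ∈ (extChartAt (𝓡 n) c).target) (i j : Fin n) :
    hessCoord g c h y i j = hessCoord g c h y j i := by
  simp only [hessCoord, Matrix.of_apply, christoffel_symm g c _ i j]
  congr 1
  exact pd_comm ((contDiffOn_funRep hh c).contDiffAt ((isOpen_chartTarget c).mem_nhds hy)) i j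

theorem divergence_smul {f : M → ℝ} (hf : SmoothFunInCharts (n := n) f) {X : VField n M}
    (hX : SmoothInCharts X) (p : M) :
    divergence g (fun q ↦ f q • X q) p =
      fderiv ℝ (funRep p f) (base p) (fieldRep p X (base p)) + f p * divergence g X p := by
  have hy := base_mem_target (n := n) p
  have hc : ∀ k, (fun z ↦ vecCoord p (fun q ↦ f q • X q) z k) =
      fun z ↦ funRep p f z * vecCoord p X z k := fun k ↦ funext fun z ↦
    congrArg (fun w : Model n ↦ w k) (fieldRep_smul p f X z)
  have hd : ∀ k, DifferentiableAt ℝ (fun z ↦ vecCoord p X z k) (base p) := fun k ↦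
    ((hX.coord p k).contDiffAt ((isOpen_chartTarget p).mem_nhds hy)).differentiableAt (by simp)
  have hfp : funRep p f (base p : Model n) = f p := funRep_chart (mem_extChartAt_source p) f
  have h1 : fderiv ℝ (funRep p f) (base p) (fieldRep p X (base p)) =
      ∑ i, pd i (funRep p f) (base p) * vecCoord p X (base p) i := by
    conv_lhs => rw [eq_sum_single (fieldRep p X (base p))]
    simp [pd, mul_comm, vecCoord, fieldRep]
  simp only [divergence, covCoord, fun k i ↦ congrFun (hc k) i]
  rw [h1, Finset.mul_sum, ← Finset.sum_add_distrib]
  refine Finset.sum_congr rfl fun i _ ↦ ?_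
  rw [pd_mul (hf.differentiableAt hy) (hd i), hfp, mul_add, Finset.mul_sum, add_assoc]
  congr 2
  exact Finset.sum_congr rfl fun j _ ↦ by ring

theorem divergence_smul_of_contMDiff {f : M → ℝ} (hf : ContMDiff (𝓡 n) 𝓘(ℝ, ℝ) ∞ f)
    {X : VField n M} (hX : SmoothInCharts X) (p : M) :
    divergence g (fun q ↦ f q • X q) p =
      g.inner p (grad g f p) (X p) + f p * divergence g X p := by
  rw [divergence_smul g (contDiffOn_funRep hf) hX, ← metricBil_grad g hf (base_mem_target p),
    inner_eq_chart g (grad g f) X (mem_extChartAt_source p)]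
  rfl

/-- Leibniz, together with X(|X|²) = 2 g(∇_X X, X). With both arguments of `covLow` equal to X, only
the metric derivative along X survives. -/
theorem divergence_normSq_smul {X : VField n M} (hX : SmoothInCharts X) (p : M) :
    divergence g (fun q ↦ normSq g X q • X q) p =
      2 * covLow g p X (base p) (fieldRep p X (base p)) (fieldRep p X (base p))
        + normSq g X p * divergence g X p := by
  have hy := base_mem_target (n := n) p
  rw [divergence_smul (f := normSq g X) g (smoothFun_inner g hX hX) hX]
  congr 1
  have hev : funRep p (normSq g X) =ᶠ[𝓝 (base p)] fun z ↦
      metricBil g p z (fieldRep p X z) (fieldRep p X z) := by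
    filter_upwards [(isOpen_chartTarget p).mem_nhds hy] with z hz
    exact funRep_inner g hz X X
  have hXd := (hX.differentiableAt hy).hasFDerivAt
  have h2 := ((differentiableAt_metricBil g hy).hasFDerivAt.clm_apply hXd).clm_apply hXd
  rw [hev.fderiv_eq, h2.fderiv, covLow_apply]
  simp only [add_apply, ContinuousLinearMap.coe_comp, Function.comp_apply,
    ContinuousLinearMap.flip_apply]
  rw [metricBil_symm g p (base p) (fieldRep p X (base p))]
  ring

/-- A Bochner-type formula: contracting ∇_i(V^j ∇_j Y^i) and commuting derivatives gives Ric(V, Y)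
plus V(div Y), which vanishes. The computation stays in the chart at `p`, so Ricci is only read
there. -/
theorem divergence_covField {V Y : VField n M} (hV : SmoothInCharts V) (hY : SmoothInCharts Y)
    (hdiv : ∀ p, divergence g Y p = 0) (p : M) :
    divergence g (covField g V Y) p = covTrace g V Y p + ricciApply g V Y p := by
  have hy := base_mem_target (n := n) p
  have hnhds := (isOpen_chartTarget p).mem_nhds hy
  have hdV : ∀ k, DifferentiableAt ℝ (fun z ↦ vecCoord p V z k) (base p) := fun k ↦
    ((hV.coord p k).contDiffAt hnhds).differentiableAt (by simp)
  have hdY : ∀ k, DifferentiableAt ℝ (fun z ↦ vecCoord p Y z k) (base p) := fun k ↦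
    ((hY.coord p k).contDiffAt hnhds).differentiableAt (by simp)
  have hdΓ : ∀ k i j, DifferentiableAt ℝ (christoffel g p k i j) (base p) := fun k i j ↦
    ((contDiffOn_christoffel g p k i j).contDiffAt hnhds).differentiableAt (by simp)
  have hdd : ∀ i k, DifferentiableAt ℝ (pd i (fun z ↦ vecCoord p Y z k)) (base p) := fun i k ↦
    ((contDiffOn_pd (isOpen_chartTarget p) (hY.coord p k) i).contDiffAt hnhds).differentiableAt
      (by simp)
  have hdN : ∀ i k, DifferentiableAt ℝ (fun z ↦ covCoord g p Y z i k) (base p) := fun i k ↦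
    ((contDiffOn_covCoord g hY p i k).contDiffAt hnhds).differentiableAt (by simp)
  have hpN : ∀ l i k, pd l (fun z ↦ covCoord g p Y z i k) (base p) =
      pd l (pd i (fun z ↦ vecCoord p Y z k)) (base p)
        + ∑ j, (pd l (christoffel g p k i j) (base p) * vecCoord p Y (base p) j
          + christoffel g p k i j (base p) * pd l (fun z ↦ vecCoord p Y z j) (base p)) := by
    intro l i k
    unfold covCoord
    rw [pd_add (hdd i k) (DifferentiableAt.fun_sum fun j _ ↦ (hdΓ k i j).fun_mul (hdY j)),
      pd_sum (fun j _ ↦ (hdΓ k i j).fun_mul (hdY j))]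
    congr 1
    exact Finset.sum_congr rfl fun j _ ↦ pd_mul (hdΓ k i j) (hdY j) l
  have hW : ∀ k, pd k (fun z ↦ vecCoord p (covField g V Y) z k) (base p) =
      ∑ j, (pd k (fun z ↦ vecCoord p V z j) (base p) * covCoord g p Y (base p) j k
        + vecCoord p V (base p) j * pd k (fun z ↦ covCoord g p Y z j k) (base p)) := by
    intro k
    have hev : (fun z ↦ vecCoord p (covField g V Y) z k) =ᶠ[𝓝 (base p)] fun z ↦
        ∑ j, vecCoord p V z j * covCoord g p Y z j k := by
      filter_upwards [hnhds] with z hz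
      exact vecCoord_covField g V hY hz k
    rw [pd_congr hev, pd_sum (fun j _ ↦ (hdV j).fun_mul (hdN j k))]
    exact Finset.sum_congr rfl fun j _ ↦ pd_mul (hdV j) (hdN j k) k
  -- At nearby points `divergence` refers to other preferred charts. Invariance turns its vanishing
  -- into that of the coordinate expression throughout the chart at `p`, which can then be
  -- differentiated.
  have hzero : ∀ j, ∑ i, pd j (fun z ↦ covCoord g p Y z i i) (base p) = 0 := by
    intro j
    rw [← pd_sum (fun i _ ↦ hdN i i)]
    have hev : (fun z ↦ ∑ i, covCoord g p Y z i i) =ᶠ[𝓝 (base p)] fun _ ↦ 0 := by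
      filter_upwards [hnhds] with z hz
      have := divergence_eq_chart g hY ((extChartAt (𝓡 n) p).map_target hz)
      rw [(extChartAt (𝓡 n) p).right_inv hz, hdiv] at this
      exact this.symm
    rw [pd_congr hev]
    simp [pd]
  simp only [divergence]
  have key := sum_commutation (fun i j ↦ pd i (fun z ↦ vecCoord p V z j) (base p))
    (fun i j ↦ pd i (fun z ↦ vecCoord p Y z j) (base p)) (covCoord g p Y (base p))
    (vecCoord p V (base p)) (vecCoord p Y (base p)) (fun k i j ↦ christoffel g p k i j (base p))
    (fun i j k ↦ pd i (pd j (fun z ↦ vecCoord p Y z k)) (base p))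
    (fun l k i j ↦ pd l (christoffel g p k i j) (base p)) (fun j i ↦ rfl)
    (fun k i j ↦ christoffel_symm g p k i j _)
    (fun i j k ↦ pd_comm ((hY.coord p k).contDiffAt hnhds) i j)
    (fun j ↦ by rw [← hzero j]; exact Finset.sum_congr rfl fun i _ ↦ (hpN j i i).symm)
  refine Eq.trans ?_ key
  refine Finset.sum_congr rfl fun i _ ↦ ?_
  rw [covCoord, hW]
  congr 1
  · exact Finset.sum_congr rfl fun j _ ↦ by rw [hpN]
  · exact Finset.sum_congr rfl fun l _ ↦ by rw [vecCoord_covField g V hY hy]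

end Pointwise

/-! ### The volume density: its logarithmic derivative and transformation law. -/

section Density

open Set Filter Topology

variable {n : ℕ}

/-- Jacobi's formula for the derivative of a determinant. -/
theorem pd_det {A : Model n → Matrix (Fin n) (Fin n) ℝ} {y : Model n}
    (hA : ∀ i j, DifferentiableAt ℝ (fun z ↦ A z i j) y) (hdet : IsUnit (A y).det) (j : Fin n) :
    pd j (fun z ↦ (A z).det) y =
      (A y).det * ∑ k, ∑ l, (A y)⁻¹ k l * pd j (fun z ↦ A z l k) y := by
  set b : Fin n → Fin n → ℝ := fun k l ↦ pd j (fun z ↦ A z l k) y with hb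
  -- Multilinearity in the columns: the derivative of the determinant replaces one column at a time
  -- by its derivative, and Cramer's rule then evaluates each term.
  have h1 : pd j (fun z ↦ (A z).det) y = ∑ k, ((A y).updateCol k (b k)).det := by
    simp only [Matrix.det_apply']
    have hprod : ∀ σ : Equiv.Perm (Fin n), HasFDerivAt (fun z ↦ ∏ i, A z (σ i) i)
        (∑ k, (∏ i ∈ Finset.univ.erase k, A y (σ i) i) • fderiv ℝ (fun z ↦ A z (σ k) k) y) y :=
      fun σ ↦ HasFDerivAt.finsetProd fun k _ ↦ (hA (σ k) k).hasFDerivAt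
    rw [pd_sum (fun σ _ ↦ (differentiableAt_const _).fun_mul (hprod σ).differentiableAt),
      Finset.sum_comm]
    refine Finset.sum_congr rfl fun σ _ ↦ ?_
    rw [pd_mul (differentiableAt_const _) (hprod σ).differentiableAt]
    have h0 : pd j (fun _ : Model n ↦ ((Equiv.Perm.sign σ : ℤ) : ℝ)) y = 0 := by simp [pd]
    rw [h0, zero_mul, zero_add, pd, (hprod σ).fderiv, ← Finset.mul_sum]
    congr 1
    simp only [sum_apply, smul_apply, smul_eq_mul]
    refine Finset.sum_congr rfl fun k _ ↦ ?_
    rw [← Finset.mul_prod_erase _ _ (Finset.mem_univ k), Matrix.updateCol_self, mul_comm]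
    congr 1
    exact Finset.prod_congr rfl fun i hi ↦ by rw [Matrix.updateCol_ne (Finset.ne_of_mem_erase hi)]
  rw [h1, Finset.mul_sum]
  refine Finset.sum_congr rfl fun k _ ↦ ?_
  rw [← Matrix.cramer_apply, Matrix.cramer_eq_adjugate_mulVec, Matrix.mulVec, dotProduct,
    Finset.mul_sum]
  refine Finset.sum_congr rfl fun l _ ↦ ?_
  rw [Matrix.inv_def, Ring.inverse_eq_inv', Matrix.smul_apply, smul_eq_mul, ← mul_assoc,
    ← mul_assoc, mul_inv_cancel₀ hdet.ne_zero, one_mul]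

variable {M : Type*} [TopologicalSpace M] [ChartedSpace (Model n) M]
  [IsManifold (𝓡 n) ∞ M] (g : Metric n M)

/-- The Riemannian volume density `√(det g_{ij})` in the chart at `c`. -/
def volDensity (c : M) (y : Model n) : ℝ := √(metricCoord g c y).det

theorem volDensity_pos {c : M} {y : Model n} (hy : y ∈ (extChartAt (𝓡 n) c).target) :
    0 < volDensity g c y :=
  Real.sqrt_pos.2 (metricCoord_det_pos g hy)

theorem contDiffOn_volDensity (c : M) :
    ContDiffOn ℝ ∞ (volDensity g c) (extChartAt (𝓡 n) c).target :=
  (contDiffOn_metricCoord_det g c).sqrt fun _ hy ↦ (metricCoord_det_pos g hy).ne'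

theorem metricCoord_inv_symm (c : M) (y : Model n) (i j : Fin n) :
    (metricCoord g c y)⁻¹ i j = (metricCoord g c y)⁻¹ j i := by
  conv_lhs => rw [← metricCoord_transpose, ← Matrix.transpose_nonsing_inv, Matrix.transpose_apply]

/-- Contracting with the symmetric inverse metric cancels the first and third metric derivatives in
the Christoffel symbol. -/
theorem sum_christoffel (c : M) (y : Model n) (j : Fin n) :
    ∑ i, christoffel g c i i j y =
      (1 / 2) * ∑ i, ∑ l, (metricCoord g c y)⁻¹ i l * pd j (fun z ↦ metricCoord g c z l i) y := by
  unfold christoffel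
  rw [← Finset.mul_sum]
  congr 1
  have h1 : ∑ i, ∑ l, (metricCoord g c y)⁻¹ i l * pd i (fun z ↦ metricCoord g c z j l) y =
      ∑ i, ∑ l, (metricCoord g c y)⁻¹ i l * pd l (fun z ↦ metricCoord g c z i j) y := by
    rw [Finset.sum_comm]
    refine Finset.sum_congr rfl fun l _ ↦ Finset.sum_congr rfl fun i _ ↦ ?_
    rw [metricCoord_inv_symm]
    congr 3
    exact funext fun z ↦ metricCoord_symm g c z _ _
  have h2 : ∑ i, ∑ l, (metricCoord g c y)⁻¹ i l * pd j (fun z ↦ metricCoord g c z i l) y =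
      ∑ i, ∑ l, (metricCoord g c y)⁻¹ i l * pd j (fun z ↦ metricCoord g c z l i) y := by
    refine Finset.sum_congr rfl fun i _ ↦ Finset.sum_congr rfl fun l _ ↦ ?_
    congr 2
    exact funext fun z ↦ metricCoord_symm g c z _ _
  simp only [mul_sub, mul_add, Finset.sum_sub_distrib, Finset.sum_add_distrib]
  rw [h1, h2]
  ring

theorem pd_volDensity {c : M} {y : Model n} (hy : y ∈ (extChartAt (𝓡 n) c).target) (j : Fin n) :
    pd j (volDensity g c) y = volDensity g c y * ∑ i, christoffel g c i i j y := by
  have hnhds := (isOpen_chartTarget c).mem_nhds hy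
  have hpos := metricCoord_det_pos g hy
  have hd : DifferentiableAt ℝ (fun z ↦ (metricCoord g c z).det) y :=
    ((contDiffOn_metricCoord_det g c).contDiffAt hnhds).differentiableAt (by simp)
  have h1 : pd j (volDensity g c) y =
      1 / (2 * volDensity g c y) * pd j (fun z ↦ (metricCoord g c z).det) y := by
    have := (hd.hasFDerivAt.sqrt hpos.ne').fderiv
    change fderiv ℝ (fun z ↦ √(metricCoord g c z).det) y _ = _
    rw [this]
    rfl
  have h2 := pd_det (A := metricCoord g c) (y := y) (fun i k ↦
    ((contDiffOn_metricCoord g c i k).contDiffAt hnhds).differentiableAt (by simp))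
    (metricCoord_isUnit g hy) j
  have h3 : (metricCoord g c y).det = volDensity g c y * volDensity g c y :=
    (Real.mul_self_sqrt hpos.le).symm
  rw [h1, h2, sum_christoffel, h3]
  have := (volDensity_pos g hy).ne'
  field_simp

/-- The contracted Christoffel term is the logarithmic derivative of the density, so the weighted
divergence is a Euclidean one and integrates by the flat theory. -/
theorem volDensity_mul_divergence {X : VField n M} (hX : SmoothInCharts X) {c : M} {y : Model n}
    (hy : y ∈ (extChartAt (𝓡 n) c).target) :
    volDensity g c y * ∑ i, covCoord g c X y i i =
      ∑ i, pd i (fun z ↦ volDensity g c z * vecCoord c X z i) y := by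
  have hnhds := (isOpen_chartTarget c).mem_nhds hy
  have hd : ∀ k, DifferentiableAt ℝ (fun z ↦ vecCoord c X z k) y := fun k ↦
    ((hX.coord c k).contDiffAt hnhds).differentiableAt (by simp)
  have hv : DifferentiableAt ℝ (volDensity g c) y :=
    ((contDiffOn_volDensity g c).contDiffAt hnhds).differentiableAt (by simp)
  simp only [covCoord, Finset.sum_add_distrib, mul_add, fun i ↦ pd_mul hv (hd i) i,
    pd_volDensity g hy]
  rw [add_comm]
  congr 1
  · rw [Finset.sum_comm, Finset.mul_sum]
    refine Finset.sum_congr rfl fun j _ ↦ ?_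
    rw [← Finset.sum_mul]
    ring
  · rw [Finset.mul_sum]

/-- The Gram matrices are related by Jᵀ G J with J the Jacobian matrix; take square roots of
determinants. -/
theorem volDensity_transition {c d : M} {y : Model n} (hy : y ∈ overlap c d) :
    volDensity g c y = |(fderiv ℝ (transition c d) y).det| * volDensity g d (transition c d y) := by
  set J := LinearMap.toMatrix (EuclideanSpace.basisFun (Fin n) ℝ).toBasis
    (EuclideanSpace.basisFun (Fin n) ℝ).toBasis (fderiv ℝ (transition c d) y).toLinearMap with hJ
  have hJdet : J.det = (fderiv ℝ (transition c d) y).det := LinearMap.det_toMatrix _ _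
  have hJa : ∀ k i, fderiv ℝ (transition c d) y (EuclideanSpace.single i 1) k = J k i := by
    intro k i
    simp [hJ, LinearMap.toMatrix_apply]
  have h1 : metricCoord g c y = Jᵀ * metricCoord g d (transition c d y) * J := by
    ext i j
    rw [← metricBil_single, metricBil_transition g hy, metricBil_apply]
    simp only [hJa, Matrix.mul_apply, Matrix.transpose_apply, Finset.sum_mul]
    rw [Finset.sum_comm]
    exact Finset.sum_congr rfl fun l _ ↦ Finset.sum_congr rfl fun k _ ↦ by ring
  rw [volDensity, h1, Matrix.det_mul, Matrix.det_mul, Matrix.det_transpose, ← hJdet,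
    ← Real.sqrt_sq_eq_abs, volDensity, ← Real.sqrt_mul (sq_nonneg _)]
  congr 1
  ring

end Density

/-! ### The Riemannian measure in charts. -/

section Volume

open Set Filter Topology

variable {n : ℕ} {M : Type*} [TopologicalSpace M] [ChartedSpace (Model n) M]

theorem measurableSet_chartTarget (c : M) : MeasurableSet (extChartAt (𝓡 n) c).target :=
  (isOpen_chartTarget c).measurableSet

variable [MeasurableSpace M] [BorelSpace M]

theorem aemeasurable_chart_symm (c : M) (f : Model n → ENNReal) :
    AEMeasurable (extChartAt (𝓡 n) c).symm
      ((volume.restrict (extChartAt (𝓡 n) c).target).withDensity f) :=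
  ((continuousOn_extChartAt_symm c).aemeasurable (measurableSet_chartTarget c)).mono_ac
    (withDensity_absolutelyContinuous _ _)

theorem measurableSet_preimage_chart_symm (c : M) {A : Set M} (hA : MeasurableSet A) :
    MeasurableSet ((extChartAt (𝓡 n) c).symm ⁻¹' A ∩ (extChartAt (𝓡 n) c).target) := by
  have h1 : Measurable ((extChartAt (𝓡 n) c).target.domRestrict (extChartAt (𝓡 n) c).symm) :=
    (continuousOn_extChartAt_symm c).domRestrict.measurable
  have h2 := (measurableSet_chartTarget c).subtype_image (h1 hA)
  convert h2 using 1
  ext y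
  simp [and_comm]

theorem measurableSet_chartSource (c : M) : MeasurableSet (extChartAt (𝓡 n) c).source :=
  (isOpen_extChartAt_source c).measurableSet

variable [IsManifold (𝓡 n) ∞ M] (g : Metric n M)

theorem chartVolume_apply (c : M) {A : Set M} (hA : MeasurableSet A) :
    chartVolume g c A = ∫⁻ y in (extChartAt (𝓡 n) c).symm ⁻¹' A ∩ (extChartAt (𝓡 n) c).target,
      ENNReal.ofReal (volDensity g c y) := by
  rw [chartVolume, Measure.map_apply_of_aemeasurable (aemeasurable_chart_symm c _) hA,
    withDensity_apply', Measure.restrict_restrict' (measurableSet_chartTarget c)]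
  rfl

/-- Change of variables along the transition map: its Jacobian factor is absorbed by
`volDensity_transition`. -/
theorem chartVolume_eq_of_subset {c d : M} {A : Set M} (hA : MeasurableSet A)
    (hc : A ⊆ (extChartAt (𝓡 n) c).source) (hd : A ⊆ (extChartAt (𝓡 n) d).source) :
    chartVolume g c A = chartVolume g d A := by
  rw [chartVolume_apply g c hA, chartVolume_apply g d hA]
  set S := (extChartAt (𝓡 n) c).symm ⁻¹' A ∩ (extChartAt (𝓡 n) c).target with hS
  have hSo : S ⊆ overlap c d := fun y hy ↦ ⟨hy.2, hd hy.1⟩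
  have himg : (extChartAt (𝓡 n) d).symm ⁻¹' A ∩ (extChartAt (𝓡 n) d).target =
      transition c d '' S := by
    ext z
    constructor
    · intro hz
      have hz' : z ∈ overlap d c := ⟨hz.2, hc hz.1⟩
      refine ⟨transition d c z, ⟨?_, transition_mem_target hz'⟩, transition_transition hz'⟩
      rw [mem_preimage, chart_symm_transition hz']
      exact hz.1
    · rintro ⟨y, hy, rfl⟩
      refine ⟨?_, transition_mem_target (hSo hy)⟩
      rw [mem_preimage, chart_symm_transition (hSo hy)]
      exact hy.1
  rw [himg, lintegral_image_eq_lintegral_abs_det_fderiv_mul volume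
    (measurableSet_preimage_chart_symm c hA) (f' := fderiv ℝ (transition c d))]
  · refine setLIntegral_congr_fun (measurableSet_preimage_chart_symm c hA) fun y hy ↦ ?_
    rw [← ENNReal.ofReal_mul (abs_nonneg _), ← volDensity_transition g (hSo hy)]
  · intro y hy
    exact ((contDiffAt_transition (hSo hy)).differentiableAt
      (by simp)).hasFDerivAt.hasFDerivWithinAt
  · intro y hy z hz hyz
    rw [← transition_transition (hSo hy), hyz, transition_transition (hSo hz)]

theorem chartVolume_compl_source (c : M) :
    chartVolume g c (extChartAt (𝓡 n) c).sourceᶜ = 0 := by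
  rw [chartVolume_apply g c (measurableSet_chartSource c).compl]
  have : (extChartAt (𝓡 n) c).symm ⁻¹' (extChartAt (𝓡 n) c).sourceᶜ ∩
      (extChartAt (𝓡 n) c).target = ∅ := by
    ext y
    simp only [mem_inter_iff, mem_preimage, mem_compl_iff, mem_empty_iff_false, iff_false]
    exact fun h ↦ h.1 ((extChartAt (𝓡 n) c).map_target h.2)
  rw [this]
  simp

theorem chartVolume_inter_source (c : M) (A : Set M) :
    chartVolume g c (A ∩ (extChartAt (𝓡 n) c).source) = chartVolume g c A :=
  measure_inter_conull (by
    refine measure_mono_null ?_ (chartVolume_compl_source g c)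
    exact fun x hx ↦ hx)

/-- The supremum is the least upper bound, so it suffices to exhibit an upper bound of all chart
measures that agrees with the one at `c` inside the domain of that chart. -/
theorem riemannianVolume_eq_chartVolume {c : M} {A : Set M} (hA : MeasurableSet A)
    (hc : A ⊆ (extChartAt (𝓡 n) c).source) : riemannianVolume g A = chartVolume g c A := by
  refine le_antisymm ?_ (le_iSup (fun d ↦ chartVolume g d) c A)
  set s := (extChartAt (𝓡 n) c).source with hs
  have hsm : MeasurableSet s := measurableSet_chartSource c
  -- Inside the domain of `c` every chart measure is at most that of `c`, by agreement on overlaps;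
  -- outside it is at most the supremum itself.
  have h1 : riemannianVolume g ≤ chartVolume g c + (riemannianVolume g).restrict sᶜ := by
    refine iSup_le fun d ↦ Measure.le_iff.2 fun B hB ↦ ?_
    rw [Measure.add_apply, Measure.restrict_apply hB, ← measure_inter_add_sdiff B hsm]
    refine add_le_add ?_ ?_
    · rw [← chartVolume_inter_source, ← chartVolume_eq_of_subset g (c := c)
        ((hB.inter hsm).inter (measurableSet_chartSource d)) (fun x hx ↦ hx.1.2) fun x hx ↦ hx.2]
      exact measure_mono fun x hx ↦ hx.1.1
    · exact le_iSup (fun d ↦ chartVolume g d) d _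
  have h2 := h1 A
  rw [Measure.add_apply, Measure.restrict_apply hA] at h2
  have h3 : A ∩ sᶜ = ∅ := by
    ext x
    simp only [mem_inter_iff, mem_compl_iff, mem_empty_iff_false, iff_false]
    exact fun hx ↦ hx.2 (hc hx.1)
  simpa [h3] using h2

theorem riemannianVolume_restrict_source (c : M) :
    (riemannianVolume g).restrict (extChartAt (𝓡 n) c).source = chartVolume g c := by
  ext A hA
  rw [Measure.restrict_apply hA, riemannianVolume_eq_chartVolume g
    (hA.inter (measurableSet_chartSource c)) inter_subset_right, chartVolume_inter_source]

/-- The density is integrable over a compact coordinate ball. On compact M this makes every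
continuous function integrable. -/
instance instIsLocallyFiniteMeasureRiemannianVolume :
    IsLocallyFiniteMeasure (riemannianVolume g) := by
  refine ⟨fun c ↦ ?_⟩
  obtain ⟨r, hr, hK⟩ := Metric.nhds_basis_closedBall.mem_iff.1
    ((isOpen_chartTarget c).mem_nhds (mem_extChartAt_target (I := 𝓡 n) c))
  set U := (extChartAt (𝓡 n) c).source ∩
    extChartAt (𝓡 n) c ⁻¹' Metric.ball (extChartAt (𝓡 n) c c) r with hU
  have hUo : IsOpen U := isOpen_extChartAt_preimage' c Metric.isOpen_ball
  refine ⟨U, hUo.mem_nhds ⟨mem_extChartAt_source c, by simpa using hr⟩, ?_⟩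
  rw [riemannianVolume_eq_chartVolume g (c := c) hUo.measurableSet inter_subset_left,
    chartVolume_apply g c hUo.measurableSet]
  have hint : IntegrableOn (volDensity g c) (Metric.closedBall (extChartAt (𝓡 n) c c) r) :=
    ((contDiffOn_volDensity g c).continuousOn.mono hK).integrableOn_compact
      (isCompact_closedBall _ _)
  refine lt_of_le_of_lt (lintegral_mono_set ?_) hint.lintegral_lt_top
  intro y hy
  have := hy.1.2
  rw [mem_preimage, (extChartAt (𝓡 n) c).right_inv hy.2] at this
  exact Metric.ball_subset_closedBall this

/-- The density is strictly positive. This is what lets a continuous nonnegative function with zero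
integral vanish everywhere, not just almost everywhere. -/
instance instIsOpenPosMeasureRiemannianVolume :
    (riemannianVolume g).IsOpenPosMeasure := by
  refine ⟨fun U hU ⟨p, hp⟩ h0 ↦ ?_⟩
  have h1 : chartVolume g p U = 0 :=
    le_antisymm ((le_iSup (fun d ↦ chartVolume g d) p U).trans h0.le) zero_le
  rw [chartVolume_apply g p hU.measurableSet] at h1
  set S := (extChartAt (𝓡 n) p).symm ⁻¹' U ∩ (extChartAt (𝓡 n) p).target with hS
  have hSo : IsOpen S := by
    rw [hS, inter_comm]
    exact (continuousOn_extChartAt_symm p).isOpen_inter_preimage (isOpen_chartTarget p) hU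
  have hSm := hSo.measurableSet
  have hae : AEMeasurable (fun y ↦ ENNReal.ofReal (volDensity g p y)) (volume.restrict S) :=
    (((contDiffOn_volDensity g p).continuousOn.mono inter_subset_right).aemeasurable
      hSm).ennreal_ofReal
  rw [lintegral_eq_zero_iff' hae, EventuallyEq, ae_restrict_iff' hSm] at h1
  have h2 : volume S = 0 := by
    refine measure_mono_null (fun y hy ↦ ?_) h1
    intro h
    have h3 := h hy
    simp only [Pi.zero_apply, ENNReal.ofReal_eq_zero] at h3
    exact absurd (volDensity_pos g hy.2) (not_lt.2 h3)
  exact (hSo.measure_pos volume ⟨base p, by rwa [mem_preimage, chart_symm_base], base_mem_target p⟩).ne' h2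

theorem integral_eq_integral_chart {c : M} {f : M → ℝ} (hf : Continuous f)
    (h0 : ∀ p ∉ (extChartAt (𝓡 n) c).source, f p = 0) :
    ∫ p, f p ∂(riemannianVolume g) =
      ∫ y in (extChartAt (𝓡 n) c).target, volDensity g c y * funRep c f y := by
  rw [← setIntegral_eq_integral_of_forall_compl_eq_zero h0, riemannianVolume_restrict_source,
    chartVolume, integral_map (aemeasurable_chart_symm c _) hf.aestronglyMeasurable,
    integral_withDensity_eq_integral_toReal_smul₀]
  · refine setIntegral_congr_fun (measurableSet_chartTarget c) fun y hy ↦ ?_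
    simp only [smul_eq_mul, funRep]
    rw [ENNReal.toReal_ofReal (Real.sqrt_nonneg _)]
    rfl
  · exact ((contDiffOn_volDensity g c).continuousOn.aemeasurable
      (measurableSet_chartTarget c)).ennreal_ofReal
  · exact Eventually.of_forall fun y ↦ ENNReal.ofReal_lt_top

end Volume

/-! ### The divergence theorem on a closed manifold. -/

section DivergenceTheorem

open Set Filter Topology

theorem integral_pd_eq_zero {n : ℕ} {u : Model n → ℝ} (hu : ContDiff ℝ 1 u)
    (hs : HasCompactSupport u) (i : Fin n) : ∫ y, pd i u y = 0 := by
  have hc : Continuous (pd i u) := (hu.continuous_fderiv (by simp)).clm_apply continuous_const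
  have hcs : HasCompactSupport (pd i u) := hs.fderiv_apply ℝ _
  -- Integration by parts against the constant function 1.
  have h := integral_mul_fderiv_eq_neg_fderiv_mul_of_integrable (μ := volume)
    (f := fun _ : Model n ↦ (1 : ℝ)) (g := u) (v := EuclideanSpace.single i 1) (by simp)
    (by simpa using! hc.integrable_of_hasCompactSupport hcs)
    (by simpa using hu.continuous.integrable_of_hasCompactSupport hs)
    (fun x _ ↦ differentiableAt_const _) (fun x _ ↦ hu.differentiable (by simp) x)
  simpa using! h

variable {n : ℕ} {M : Type*} [TopologicalSpace M] [ChartedSpace (Model n) M]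

theorem fieldRep_eq_zero {c : M} {X : VField n M} {y : Model n}
    (h : X ((extChartAt (𝓡 n) c).symm y) = 0) : fieldRep c X y = 0 := by
  rw [fieldRep, h]
  exact map_zero (mvfderiv (𝓡 n) (extChartAt (𝓡 n) c) _)

variable [IsManifold (𝓡 n) ∞ M] (g : Metric n M)

theorem divergence_eq_zero_of_notMem {X : VField n M} {K : Set M} (hK : IsClosed K)
    (hX : ∀ p ∉ K, X p = 0) {p : M} (hp : p ∉ K) : divergence g X p = 0 := by
  have hev : ∀ᶠ z in 𝓝 (base p : Model n), fieldRep p X z = 0 := by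
    have h1 : (extChartAt (𝓡 n) p).target ∩ (extChartAt (𝓡 n) p).symm ⁻¹' Kᶜ ∈
        𝓝 (base p : Model n) :=
      ((continuousOn_extChartAt_symm p).isOpen_inter_preimage (isOpen_chartTarget p)
        hK.isOpen_compl).mem_nhds ⟨base_mem_target p, by rwa [mem_preimage, chart_symm_base]⟩
    filter_upwards [h1] with z hz
    exact fieldRep_eq_zero (hX _ hz.2)
  have hv : ∀ j, vecCoord p X (base p) j = 0 := fun j ↦
    congrArg (fun w : Model n ↦ w j) hev.self_of_nhds
  have hpd : ∀ i, pd i (fun z ↦ vecCoord p X z i) (base p) = 0 := by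
    intro i
    have : (fun z ↦ vecCoord p X z i) =ᶠ[𝓝 (base p)] fun _ ↦ 0 := by
      filter_upwards [hev] with z hz
      exact congrArg (fun w : Model n ↦ w i) hz
    rw [pd_congr this]
    simp [pd]
  simp [divergence, covCoord, hv, hpd]

theorem covCoord_sum {ι : Type*} (s : Finset ι) {X : ι → VField n M}
    (hX : ∀ a ∈ s, SmoothInCharts (X a)) {c : M} {y : Model n}
    (hy : y ∈ (extChartAt (𝓡 n) c).target) (i k : Fin n) :
    covCoord g c (fun p ↦ ∑ a ∈ s, X a p) y i k = ∑ a ∈ s, covCoord g c (X a) y i k := by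
  have hv : ∀ k z, vecCoord c (fun p ↦ ∑ a ∈ s, X a p) z k = ∑ a ∈ s, vecCoord c (X a) z k := by
    intro k z
    have := congrArg (fun w : Model n ↦ w k) (fieldRep_sum s c X z)
    simpa using! this
  simp only [covCoord, hv, Finset.sum_add_distrib]
  rw [pd_sum fun a ha ↦ (((hX a ha).coord c k).contDiffAt
    ((isOpen_chartTarget c).mem_nhds hy)).differentiableAt (by simp)]
  congr 1
  simp only [Finset.mul_sum]
  exact Finset.sum_comm

theorem covCoord_add {X Y : VField n M} (hX : SmoothInCharts X) (hY : SmoothInCharts Y) {c : M}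
    {y : Model n} (hy : y ∈ (extChartAt (𝓡 n) c).target) (i k : Fin n) :
    covCoord g c (fun p ↦ X p + Y p) y i k = covCoord g c X y i k + covCoord g c Y y i k := by
  have h := covCoord_sum g Finset.univ (X := ![X, Y]) (by simp [Fin.forall_fin_two, hX, hY]) hy i k
  simpa [Fin.sum_univ_two] using h

theorem divergence_sum {ι : Type*} (s : Finset ι) {X : ι → VField n M}
    (hX : ∀ a ∈ s, SmoothInCharts (X a)) (p : M) :
    divergence g (fun q ↦ ∑ a ∈ s, X a q) p = ∑ a ∈ s, divergence g (X a) p := by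
  simp only [divergence, covCoord_sum g s hX (base_mem_target p)]
  exact Finset.sum_comm

variable [MeasurableSpace M] [BorelSpace M]

theorem integral_divergence_eq_zero_of_subset_source [T2Space M] {X : VField n M} (hX : SmoothInCharts X)
    {c : M} {K : Set M} (hK : IsCompact K) (hKc : K ⊆ (extChartAt (𝓡 n) c).source)
    (hXK : ∀ p ∉ K, X p = 0) : ∫ p, divergence g X p ∂(riemannianVolume g) = 0 := by
  set T := (extChartAt (𝓡 n) c).target with hT
  have hTo : IsOpen T := isOpen_chartTarget c
  -- The components √(det g) Xⁱ extended by zero. They vanish off the compact image of `K`, which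
  -- lies inside the open target, so the extension is smooth on all of ℝⁿ.
  set u : Fin n → Model n → ℝ := fun i ↦
    T.indicator fun y ↦ volDensity g c y * vecCoord c X y i with hu
  set K' := extChartAt (𝓡 n) c '' K with hK'
  have hK'c : IsCompact K' := hK.image_of_continuousOn ((continuousOn_extChartAt c).mono hKc)
  have hK'T : K' ⊆ T := by
    rintro _ ⟨p, hp, rfl⟩
    exact (extChartAt (𝓡 n) c).map_source (hKc hp)
  have hzero : ∀ i, ∀ y ∉ K', u i y = 0 := by
    intro i y hy
    by_cases hyT : y ∈ T
    · have : fieldRep c X y = 0 := fieldRep_eq_zero (hXK _ fun h ↦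
        hy ⟨_, h, (extChartAt (𝓡 n) c).right_inv hyT⟩)
      have h2 : vecCoord c X y i = 0 := congrArg (fun w : Model n ↦ w i) this
      simp [hu, h2]
    · simp [hu, hyT]
  have hnear : ∀ i, ∀ y ∉ K', u i =ᶠ[𝓝 y] fun _ ↦ 0 := by
    intro i y hy
    filter_upwards [hK'c.isClosed.isOpen_compl.mem_nhds hy] with z hz
    exact hzero i z hz
  have hin : ∀ i, ∀ y ∈ T, u i =ᶠ[𝓝 y] fun y ↦ volDensity g c y * vecCoord c X y i := by
    intro i y hy
    filter_upwards [hTo.mem_nhds hy] with z hz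
    exact indicator_of_mem hz _
  have hsmooth : ∀ i, ContDiff ℝ 1 (u i) := by
    intro i
    refine contDiff_iff_contDiffAt.2 fun y ↦ ?_
    by_cases hy : y ∈ T
    · refine ContDiffAt.congr_of_eventuallyEq ?_ (hin i y hy)
      exact (((contDiffOn_volDensity g c).mul (hX.coord c i)).contDiffAt
        (hTo.mem_nhds hy)).of_le (by simp)
    · exact contDiffAt_const.congr_of_eventuallyEq (hnear i y fun h ↦ hy (hK'T h))
  have hcs : ∀ i, HasCompactSupport (u i) := fun i ↦ HasCompactSupport.intro hK'c (hzero i)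
  have hint : ∀ i, Integrable (pd i (u i)) := fun i ↦
    (((hsmooth i).continuous_fderiv (by simp)).clm_apply
      continuous_const).integrable_of_hasCompactSupport ((hcs i).fderiv_apply ℝ _)
  rw [integral_eq_integral_chart g (continuous_divergence g hX) (c := c) fun p hp ↦
    divergence_eq_zero_of_notMem g hK.isClosed hXK fun h ↦ hp (hKc h)]
  calc ∫ y in T, volDensity g c y * funRep c (divergence g X) y
      = ∫ y in T, ∑ i, pd i (u i) y := by
        refine setIntegral_congr_fun hTo.measurableSet fun y hy ↦ ?_
        have h1 := divergence_eq_chart g hX ((extChartAt (𝓡 n) c).map_target hy)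
        rw [(extChartAt (𝓡 n) c).right_inv hy] at h1
        simp only [funRep, h1]
        rw [volDensity_mul_divergence g hX hy]
        exact Finset.sum_congr rfl fun i _ ↦ (pd_congr (hin i y hy) i).symm
    _ = ∫ y, ∑ i, pd i (u i) y := by
        refine setIntegral_eq_integral_of_forall_compl_eq_zero fun y hy ↦ ?_
        refine Finset.sum_eq_zero fun i _ ↦ ?_
        rw [pd_congr (hnear i y fun h ↦ hy (hK'T h))]
        simp [pd]
    _ = ∑ i, ∫ y, pd i (u i) y := integral_finsetSum _ fun i _ ↦ hint i
    _ = 0 := Finset.sum_eq_zero fun i _ ↦ integral_pd_eq_zero (hsmooth i) (hcs i) i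

variable [CompactSpace M]

theorem integrable_of_continuous {f : M → ℝ} (hf : Continuous f) :
    Integrable f (riemannianVolume g) :=
  hf.integrable_of_hasCompactSupport (HasCompactSupport.of_compactSpace f)

/-- The divergence theorem on a closed Riemannian manifold. -/
theorem integral_divergence_eq_zero [T2Space M] {X : VField n M} (hX : SmoothInCharts X) :
    ∫ p, divergence g X p ∂(riemannianVolume g) = 0 := by
  obtain ⟨t, ht⟩ := isCompact_univ.elim_finite_subcover
    (fun c : M ↦ (extChartAt (𝓡 n) c).source) (fun c ↦ isOpen_extChartAt_source c)
    (fun p _ ↦ mem_iUnion.2 ⟨p, mem_extChartAt_source p⟩)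
  -- Indexing the partition by a finite subcover makes X = Σ ρ_c X a finite sum, to which additivity
  -- of the divergence applies.
  obtain ⟨ρ, hρ⟩ := SmoothPartitionOfUnity.exists_isSubordinate (𝓡 n) isClosed_univ
    (fun c : t ↦ (extChartAt (𝓡 n) (c : M)).source) (fun c ↦ isOpen_extChartAt_source _)
    (fun p hp ↦ by
      obtain ⟨c, hc⟩ := mem_iUnion.1 (ht hp)
      obtain ⟨hct, hpc⟩ := mem_iUnion.1 hc
      exact mem_iUnion.2 ⟨⟨c, hct⟩, hpc⟩)
  have hsm : ∀ c : t, SmoothInCharts (fun p ↦ ρ c p • X p) := fun c ↦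
    SmoothInCharts.smul (contDiffOn_funRep (ρ c).contMDiff) hX
  have hsum : X = fun p ↦ ∑ c : t, ρ c p • X p := by
    funext p
    have h1 := ρ.sum_eq_one (mem_univ p)
    rw [finsum_eq_sum_of_fintype] at h1
    rw [← Finset.sum_smul, h1, one_smul]
  have hdiv : ∀ p, divergence g X p = ∑ c : t, divergence g (fun q ↦ ρ c q • X q) p := by
    intro p
    conv_lhs => rw [hsum]
    exact divergence_sum g Finset.univ (fun c _ ↦ hsm c) p
  simp only [hdiv]
  rw [integral_finsetSum _ fun c _ ↦ integrable_of_continuous g (continuous_divergence g (hsm c))]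
  refine Finset.sum_eq_zero fun c _ ↦ ?_
  refine integral_divergence_eq_zero_of_subset_source g (hsm c) (K := tsupport (ρ c))
    (isClosed_tsupport _).isCompact (hρ c) fun p hp ↦ ?_
  rw [image_eq_zero_of_notMem_tsupport hp, zero_smul]

theorem eq_zero_of_integral_nonpos {f : M → ℝ} (hf : Continuous f) (h0 : ∀ p, 0 ≤ f p)
    (hint : ∫ p, f p ∂(riemannianVolume g) ≤ 0) (p : M) : f p = 0 := by
  have h1 := (integral_eq_zero_iff_of_nonneg h0 (integrable_of_continuous g hf)).1
    (le_antisymm hint (integral_nonneg h0))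
  have h2 := (Continuous.ae_eq_iff_eq (riemannianVolume g) hf continuous_zero).1 h1
  exact congrFun h2 p

end DivergenceTheorem

/-! ### Linear algebra of the soliton equation at a point, with G the Gram matrix. -/

section MatrixAlgebra

open Matrix

variable {n : ℕ} {G A B : Matrix (Fin n) (Fin n) ℝ}

/-- Raising both indices of w♭ ⊗ w♭ gives w wᵀ, so pairing with it evaluates S on (w, w). -/
theorem trace_vecMulVec_mul (G S : Matrix (Fin n) (Fin n) ℝ) (hG : IsUnit G.det) (hGt : Gᵀ = G)
    (w : Fin n → ℝ) : (vecMulVec (G *ᵥ w) (G *ᵥ w) * G⁻¹ * S * G⁻¹).trace = w ⬝ᵥ S *ᵥ w := by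
  have h1 : G⁻¹ * vecMulVec (G *ᵥ w) (G *ᵥ w) * G⁻¹ = vecMulVec w w := by
    rw [mul_vecMulVec, vecMulVec_mul, mulVec_mulVec, nonsing_inv_mul _ hG, one_mulVec,
      ← vecMul_transpose, hGt, vecMul_vecMul, mul_nonsing_inv _ hG, vecMul_one]
  rw [trace_mul_comm, ← Matrix.mul_assoc, ← Matrix.mul_assoc, h1, vecMulVec_mul,
    trace_vecMulVec, dotProduct_mulVec, dotProduct_comm]

/-- The trace is |S|² with respect to G. Writing G⁻¹ as a sum of a aᵀ turns it into a sum of values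
of the semidefinite form S G⁻¹ S. -/
theorem trace_mul_inv_sq_nonneg (hG : G.PosDef) {S : Matrix (Fin n) (Fin n) ℝ} (hS : Sᵀ = S) :
    0 ≤ (S * G⁻¹ * S * G⁻¹).trace := by
  obtain ⟨k, a, ha⟩ := Matrix.posSemidef_iff_eq_sum_vecMulVec.1 hG.inv.posSemidef
  have h1 : (Sᴴ * G⁻¹ * S).PosSemidef := hG.inv.posSemidef.conjTranspose_mul_mul_same S
  rw [conjTranspose_eq_transpose_of_trivial, hS] at h1
  generalize S * G⁻¹ * S = P at h1 ⊢
  rw [ha, Matrix.mul_sum, trace_sum]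
  refine Finset.sum_nonneg fun i _ ↦ ?_
  rw [mul_vecMulVec, trace_vecMulVec, dotProduct_comm]
  exact h1.dotProduct_mulVec_nonneg (a i)

theorem sq_trace_le (hG : G.PosDef) {S : Matrix (Fin n) (Fin n) ℝ} (hS : Sᵀ = S) :
    (S * G⁻¹).trace ^ 2 ≤ n * (S * G⁻¹ * S * G⁻¹).trace := by
  have hu : IsUnit G.det := hG.det_pos.ne'.isUnit
  have hGt : Gᵀ = G := by
    rw [← conjTranspose_eq_transpose_of_trivial]; exact hG.isHermitian
  rcases Nat.eq_zero_or_pos n with rfl | hn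
  · simp [Matrix.trace]
  have hn' : (0 : ℝ) < n := by exact_mod_cast hn
  set t := (S * G⁻¹).trace with ht
  -- The trace-free part of S has nonnegative squared norm |S|² − t²/n.
  have h := trace_mul_inv_sq_nonneg hG (S := S - (t / n) • G) (by simp [hS, hGt])
  have h1 : (S - (t / n) • G) * G⁻¹ = S * G⁻¹ - (t / n) • (1 : Matrix (Fin n) (Fin n) ℝ) := by
    rw [Matrix.sub_mul, Matrix.smul_mul, mul_nonsing_inv _ hu]
  have h2 : ((S - (t / n) • G) * G⁻¹ * (S - (t / n) • G) * G⁻¹).trace =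
      (S * G⁻¹ * S * G⁻¹).trace - t ^ 2 / n := by
    rw [Matrix.mul_assoc, h1]
    simp only [Matrix.sub_mul, Matrix.mul_sub, Matrix.smul_mul, Matrix.mul_smul, Matrix.one_mul, Matrix.mul_one,
      trace_sub, trace_smul, ← ht, trace_one, Fintype.card_fin, smul_eq_mul, ← Matrix.mul_assoc]
    field_simp
    ring
  rw [h2] at h
  have h3 : t ^ 2 / n ≤ (S * G⁻¹ * S * G⁻¹).trace := by linarith
  rwa [div_le_iff₀ hn', mul_comm] at h3

variable {x v : Fin n → ℝ} {m s : ℝ}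

theorem trace_of_soliton (hG : IsUnit G.det) (hGt : Gᵀ = G) {N : Matrix (Fin n) (Fin n) ℝ}
    (heq : (1 / 2 : ℝ) • (N * G + (N * G)ᵀ) - (1 / m) • vecMulVec (G *ᵥ x) (G *ᵥ x) = s • G) :
    N.trace = (1 / m) * (x ⬝ᵥ G *ᵥ x) + n * s := by
  have h := congrArg (fun S ↦ (S * G⁻¹).trace) heq
  have h1 : (N * G * G⁻¹).trace = N.trace := by
    rw [Matrix.mul_assoc, mul_nonsing_inv _ hG, Matrix.mul_one]
  have h2 : ((N * G)ᵀ * G⁻¹).trace = N.trace := by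
    rw [transpose_mul, hGt, trace_mul_comm, ← Matrix.mul_assoc, nonsing_inv_mul _ hG,
      Matrix.one_mul, trace_transpose]
  have h3 : (vecMulVec (G *ᵥ x) (G *ᵥ x) * G⁻¹).trace = x ⬝ᵥ G *ᵥ x := by
    have := trace_vecMulVec_mul G G hG hGt x
    rwa [Matrix.mul_assoc, mul_nonsing_inv _ hG, Matrix.mul_one] at this
  simp only [Matrix.sub_mul, Matrix.add_mul, Matrix.smul_mul, trace_sub, trace_smul, trace_add, h1, h2,
    h3, mul_nonsing_inv _ hG, trace_one, Fintype.card_fin, smul_eq_mul] at h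
  linarith

theorem dotProduct_of_soliton {N : Matrix (Fin n) (Fin n) ℝ}
    (heq : (1 / 2 : ℝ) • (N * G + (N * G)ᵀ) - (1 / m) • vecMulVec (G *ᵥ x) (G *ᵥ x) = s • G) :
    x ⬝ᵥ (N * G) *ᵥ x = (1 / m) * (x ⬝ᵥ G *ᵥ x) ^ 2 + s * (x ⬝ᵥ G *ᵥ x) := by
  have h := congrArg (fun S ↦ x ⬝ᵥ S *ᵥ x) heq
  have h1 : x ⬝ᵥ (N * G)ᵀ *ᵥ x = x ⬝ᵥ (N * G) *ᵥ x := by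
    rw [mulVec_transpose, dotProduct_comm, dotProduct_mulVec]
  have h2 : x ⬝ᵥ vecMulVec (G *ᵥ x) (G *ᵥ x) *ᵥ x = (x ⬝ᵥ G *ᵥ x) ^ 2 := by
    rw [vecMulVec_mulVec, dotProduct_smul, dotProduct_comm (G *ᵥ x) x]
    simp [sq]
  simp only [sub_mulVec, add_mulVec, smul_mulVec, dotProduct_sub, dotProduct_add, dotProduct_smul,
    h1, h2, smul_eq_mul] at h
  linarith

/-- Here A, B stand for ∇∇h and ∇Y. Pairing the equation with the symmetric form A G discards the
antisymmetric part of (A + B) G, so the pairing is tr(A(A + B)). -/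
theorem trace_mul_of_soliton (hG : IsUnit G.det) (hGt : Gᵀ = G) (hH : (A * G)ᵀ = A * G)
    (heq : (1 / 2 : ℝ) • ((A + B) * G + ((A + B) * G)ᵀ)
      - (1 / m) • vecMulVec (G *ᵥ x) (G *ᵥ x) = s • G) :
    (A * B).trace = (1 / m) * (x ⬝ᵥ (A * G) *ᵥ x) + s * A.trace - (A * A).trace := by
  have hGit : (G⁻¹)ᵀ = G⁻¹ := by rw [transpose_nonsing_inv, hGt]
  have h1 : ∀ P : Matrix (Fin n) (Fin n) ℝ, (P * G * G⁻¹ * (A * G) * G⁻¹).trace =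
      (A * P).trace := by
    intro P
    rw [Matrix.mul_assoc P, mul_nonsing_inv _ hG, Matrix.mul_one, ← Matrix.mul_assoc,
      Matrix.mul_assoc, mul_nonsing_inv _ hG, Matrix.mul_one, trace_mul_comm]
  have h2 : ∀ P : Matrix (Fin n) (Fin n) ℝ, ((P * G)ᵀ * G⁻¹ * (A * G) * G⁻¹).trace =
      (A * P).trace := by
    intro P
    rw [← h1 P]
    generalize A * G = H at hH
    generalize P * G = Q
    rw [← trace_transpose, transpose_mul, transpose_mul, transpose_mul, hGit, hH,
      transpose_transpose, ← Matrix.mul_assoc, ← Matrix.mul_assoc, trace_mul_comm,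
      ← Matrix.mul_assoc, ← Matrix.mul_assoc]
  have hN : (A * (A + B)).trace = (A * A).trace + (A * B).trace := by
    rw [Matrix.mul_add, trace_add]
  generalize A + B = N at heq hN
  have h := congrArg (fun S ↦ (S * G⁻¹ * (A * G) * G⁻¹).trace) heq
  have h4 : (G * G⁻¹ * (A * G) * G⁻¹).trace = A.trace := by
    rw [mul_nonsing_inv _ hG, Matrix.one_mul, Matrix.mul_assoc, mul_nonsing_inv _ hG,
      Matrix.mul_one]
  simp only [Matrix.sub_mul, Matrix.add_mul, Matrix.smul_mul, trace_sub, trace_smul, trace_add,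
    h1, h2, trace_vecMulVec_mul G _ hG hGt, h4, smul_eq_mul] at h
  linarith

/-- The squared norm of `∇²h - (1/m) dh ⊗ dh - s g`, expanded. -/
theorem trace_sq_defect (hG : IsUnit G.det) (hGt : Gᵀ = G) (A : Matrix (Fin n) (Fin n) ℝ)
    (v : Fin n → ℝ) (m s : ℝ) :
    ((A * G - (1 / m) • vecMulVec (G *ᵥ v) (G *ᵥ v) - s • G) * G⁻¹ *
      (A * G - (1 / m) • vecMulVec (G *ᵥ v) (G *ᵥ v) - s • G) * G⁻¹).trace =
      (A * A).trace + (1 / m ^ 2) * (v ⬝ᵥ G *ᵥ v) ^ 2 + n * s ^ 2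
        - (2 / m) * (v ⬝ᵥ (A * G) *ᵥ v) - 2 * s * A.trace
        + (2 * s / m) * (v ⬝ᵥ G *ᵥ v) := by
  set D := vecMulVec (G *ᵥ v) (G *ᵥ v) with hD
  have h1 : (A * G - (1 / m) • D - s • G) * G⁻¹ = A - (1 / m) • (D * G⁻¹) - s • 1 := by
    simp only [Matrix.sub_mul, Matrix.smul_mul, mul_nonsing_inv _ hG]
    rw [Matrix.mul_assoc, mul_nonsing_inv _ hG, Matrix.mul_one]
  have h2 : (D * G⁻¹ * A).trace = v ⬝ᵥ (A * G) *ᵥ v := by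
    have := trace_vecMulVec_mul G (A * G) hG hGt v
    rwa [Matrix.mul_assoc, Matrix.mul_assoc A, mul_nonsing_inv _ hG, Matrix.mul_one] at this
  have h3 : (D * G⁻¹).trace = v ⬝ᵥ G *ᵥ v := by
    have := trace_vecMulVec_mul G G hG hGt v
    rwa [Matrix.mul_assoc, mul_nonsing_inv _ hG, Matrix.mul_one] at this
  have h4 : (D * G⁻¹ * (D * G⁻¹)).trace = (v ⬝ᵥ G *ᵥ v) ^ 2 := by
    have := trace_vecMulVec_mul G D hG hGt v
    rw [← Matrix.mul_assoc, this, hD, vecMulVec_mulVec, dotProduct_smul,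
      dotProduct_comm (G *ᵥ v) v]
    simp [sq]
  rw [Matrix.mul_assoc, h1]
  simp only [Matrix.sub_mul, Matrix.mul_sub, Matrix.smul_mul, Matrix.mul_smul, Matrix.one_mul, Matrix.mul_one,
    trace_sub, trace_smul, trace_one, Fintype.card_fin, smul_eq_mul, h2, h3, h4,
    trace_mul_comm A (D * G⁻¹)]
  ring

end MatrixAlgebra

/-! ### The soliton equation, the integrand as a square plus divergences, and L² orthogonality. -/

section Soliton

open Matrix

variable {n : ℕ} {M : Type*} [TopologicalSpace M] [ChartedSpace (Model n) M]
  [IsManifold (𝓡 n) ∞ M] (g : Metric n M)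

/-- The matrix `∇ᵢ Xᵏ` at `p`. -/
def covMat (X : VField n M) (p : M) : Matrix (Fin n) (Fin n) ℝ :=
  Matrix.of (covCoord g p X (base p))

theorem metricAt_posDef (p : M) : (metricAt g p).PosDef :=
  metricCoord_posDef g (base_mem_target p)

theorem metricAt_isUnit (p : M) : IsUnit (metricAt g p).det :=
  metricCoord_isUnit g (base_mem_target p)

theorem metricAt_transpose (p : M) : (metricAt g p)ᵀ = metricAt g p :=
  metricCoord_transpose g p (base p)

theorem lieMetric_eq {X : VField n M} (hX : SmoothInCharts X) (p : M) :
    lieMetric g X p = covMat g X p * metricAt g p + (covMat g X p * metricAt g p)ᵀ := by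
  ext i j
  rw [lieMetric, lieCoord_eq g hX (base_mem_target p)]
  rfl

theorem hess_eq {h : M → ℝ} (hh : ContMDiff (𝓡 n) 𝓘(ℝ, ℝ) ∞ h) (p : M) :
    hess g h p = covMat g (grad g h) p * metricAt g p := by
  ext i j
  rw [hess, hessCoord_eq g hh (base_mem_target p)]
  rfl

theorem hess_transpose {h : M → ℝ} (hh : ContMDiff (𝓡 n) 𝓘(ℝ, ℝ) ∞ h) (p : M) :
    (hess g h p)ᵀ = hess g h p := by
  ext i j
  exact hessCoord_symm g hh (base_mem_target p) j i

theorem diffAt_eq {h : M → ℝ} (hh : ContMDiff (𝓡 n) 𝓘(ℝ, ℝ) ∞ h) (p : M) :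
    diffAt h p = metricAt g p *ᵥ vecAt (grad g h) p := by
  ext l
  rw [diffAt, diffCoord_eq g hh (base_mem_target p), mulVec, dotProduct]
  exact Finset.sum_congr rfl fun k _ ↦ by
    rw [mul_comm, metricCoord_symm]
    rfl

theorem metricBil_eq_dotProduct (p : M) (u w : Model n) :
    metricBil g p (base p) u w = u.ofLp ⬝ᵥ metricAt g p *ᵥ w.ofLp := by
  rw [metricBil_apply]
  simp only [dotProduct, mulVec, Finset.mul_sum, metricAt]
  exact Finset.sum_congr rfl fun i _ ↦ Finset.sum_congr rfl fun j _ ↦ by ring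

theorem normSq_eq (X : VField n M) (p : M) :
    normSq g X p = vecAt X p ⬝ᵥ metricAt g p *ᵥ vecAt X p := by
  rw [normSq, inner_eq_chart g X X (mem_extChartAt_source p)]
  exact metricBil_eq_dotProduct g p _ _

theorem divergence_eq_trace (X : VField n M) (p : M) : divergence g X p = (covMat g X p).trace :=
  rfl

theorem covTrace_eq_trace (X Y : VField n M) (p : M) :
    covTrace g X Y p = (covMat g X p * covMat g Y p).trace :=
  rfl

theorem divergence_normSq_smul_eq {X : VField n M} (hX : SmoothInCharts X) (p : M) :
    divergence g (fun q ↦ normSq g X q • X q) p =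
      2 * (vecAt X p ⬝ᵥ (covMat g X p * metricAt g p) *ᵥ vecAt X p)
        + normSq g X p * divergence g X p := by
  rw [divergence_normSq_smul g hX, ← metricBil_covLin g hX (base_mem_target p),
    metricBil_eq_dotProduct]
  congr 2
  have h1 : (covLin g p X (base p) (fieldRep p X (base p))).ofLp = vecAt X p ᵥ* covMat g X p := by
    ext k
    rw [covLin_apply]
    rfl
  rw [h1, ← mulVec_mulVec, dotProduct_mulVec (vecAt X p)]
  rfl

theorem tensorInner_vecMulVec (p : M) (S : Matrix (Fin n) (Fin n) ℝ) (w : Fin n → ℝ) :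
    tensorInner g p S (vecMulVec (metricAt g p *ᵥ w) (metricAt g p *ᵥ w)) = w ⬝ᵥ S *ᵥ w := by
  have hw : ∀ i, ∑ k, (metricAt g p)⁻¹ i k * (metricAt g p *ᵥ w) k = w i := by
    intro i
    change ((metricAt g p)⁻¹ *ᵥ (metricAt g p *ᵥ w)) i = w i
    rw [mulVec_mulVec, nonsing_inv_mul _ (metricAt_isUnit g p), one_mulVec]
  generalize metricAt g p *ᵥ w = u at hw ⊢
  simp only [tensorInner, dotProduct, mulVec, Finset.mul_sum, vecMulVec_apply]
  refine Finset.sum_congr rfl fun i _ ↦ Finset.sum_congr rfl fun j _ ↦ ?_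
  conv_rhs => rw [← hw i, ← hw j]
  rw [Finset.sum_mul]
  refine Finset.sum_congr rfl fun k _ ↦ ?_
  simp only [Finset.mul_sum]
  exact Finset.sum_congr rfl fun l _ ↦ by ring

theorem covMat_add {X Y : VField n M} (hX : SmoothInCharts X) (hY : SmoothInCharts Y) (p : M) :
    covMat g (fun q ↦ X q + Y q) p = covMat g X p + covMat g Y p := by
  ext i k
  exact covCoord_add g hX hY (base_mem_target p) i k

/-- The squared norm of `∇²h - (1/m) dh ⊗ dh - s g`. -/
def defect (m : ℝ) (s : M → ℝ) (h : M → ℝ) (p : M) : ℝ :=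
  covTrace g (grad g h) (grad g h) p + (1 / m ^ 2) * normSq g (grad g h) p ^ 2 + n * s p ^ 2
    - (1 / m) * (divergence g (fun q ↦ normSq g (grad g h) q • grad g h q) p
      - normSq g (grad g h) p * divergence g (grad g h) p)
    - 2 * s p * divergence g (grad g h) p + (2 * s p / m) * normSq g (grad g h) p

/-- `defect` is assembled from functions already known to be continuous, whereas the matrix
expression lives in varying charts. In particular ∇²h(∇h, ∇h) is encoded by div(|∇h|² ∇h) − |∇h|²
Δh, which is twice it. -/
theorem defect_eq {h : M → ℝ} (hh : ContMDiff (𝓡 n) 𝓘(ℝ, ℝ) ∞ h) (m : ℝ) (s : M → ℝ) (p : M) :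
    defect g m s h p =
      ((hess g h p - (1 / m) • vecMulVec (diffAt h p) (diffAt h p) - s p • metricAt g p) *
        (metricAt g p)⁻¹ *
        (hess g h p - (1 / m) • vecMulVec (diffAt h p) (diffAt h p) - s p • metricAt g p) *
        (metricAt g p)⁻¹).trace := by
  rw [hess_eq g hh, diffAt_eq g hh, trace_sq_defect (metricAt_isUnit g p) (metricAt_transpose g p),
    defect, divergence_normSq_smul_eq g (smoothInCharts_grad g hh), normSq_eq, covTrace_eq_trace,
    divergence_eq_trace]
  ring

theorem continuous_normSq {X : VField n M} (hX : SmoothInCharts X) : Continuous (normSq g X) :=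
  (smoothFun_inner g hX hX).continuous

theorem SmoothInCharts.normSq_smul {X : VField n M} (hX : SmoothInCharts X) :
    SmoothInCharts (fun q ↦ normSq g X q • X q) :=
  SmoothInCharts.smul (f := normSq g X) (smoothFun_inner g hX hX) hX

theorem continuous_defect {h : M → ℝ} (hh : ContMDiff (𝓡 n) 𝓘(ℝ, ℝ) ∞ h) (m : ℝ) {s : M → ℝ}
    (hs : Continuous s) : Continuous (defect g m s h) := by
  have hV := smoothInCharts_grad g hh
  have h1 := continuous_covTrace g hV hV
  have h2 := continuous_normSq g hV
  have h3 := continuous_divergence g hV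
  have h4 := continuous_divergence g (hV.normSq_smul g)
  unfold defect
  fun_prop

variable {g} {k : ℕ} {m lam : ℝ} {X Y : VField n M} {h : M → ℝ}

theorem IsQuasiYamabeSoliton.equation_covMat (hX : IsQuasiYamabeSoliton g k m lam X) (p : M) :
    (1 / 2 : ℝ) • (covMat g X p * metricAt g p + (covMat g X p * metricAt g p)ᵀ)
      - (1 / m) • vecMulVec (metricAt g p *ᵥ vecAt X p) (metricAt g p *ᵥ vecAt X p)
    = (sigma g k p - lam) • metricAt g p := by
  rw [← lieMetric_eq g hX.smooth.smoothInCharts]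
  exact hX.equation p

theorem IsQuasiYamabeSoliton.divergence_eq (hX : IsQuasiYamabeSoliton g k m lam X) (p : M) :
    divergence g X p = (1 / m) * normSq g X p + n * (sigma g k p - lam) := by
  rw [divergence_eq_trace, normSq_eq]
  exact trace_of_soliton (metricAt_isUnit g p) (metricAt_transpose g p) (hX.equation_covMat p)

/-- Tracing the soliton equation gives σ_k − λ = (div X − |X|²/m)/n, which avoids any study of how
the roots of the characteristic polynomial vary. -/
theorem IsQuasiYamabeSoliton.continuous_sigma (hX : IsQuasiYamabeSoliton g k m lam X)
    (hn : n ≠ 0) : Continuous fun p ↦ sigma g k p - lam := by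
  have hn' : (n : ℝ) ≠ 0 := by exact_mod_cast hn
  have h1 : (fun p ↦ sigma g k p - lam) =
      fun p ↦ (divergence g X p - (1 / m) * normSq g X p) / n := by
    funext p
    rw [hX.divergence_eq]
    field_simp
    ring
  rw [h1]
  have h2 := continuous_normSq g hX.smooth.smoothInCharts
  have h3 := continuous_divergence g hX.smooth.smoothInCharts
  fun_prop

theorem IsHodgeDecomposition.covMat_eq (hXY : IsHodgeDecomposition g X h Y) (p : M) :
    covMat g X p = covMat g (grad g h) p + covMat g Y p := by
  rw [funext hXY.decomposition]
  exact covMat_add g (smoothInCharts_grad g hXY.smooth_potential)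
    hXY.smooth_field.smoothInCharts p

theorem IsHodgeDecomposition.divergence_eq (hXY : IsHodgeDecomposition g X h Y) (p : M) :
    divergence g X p = divergence g (grad g h) p := by
  have := hXY.divergence_free p
  rw [divergence_eq_trace] at this
  rw [divergence_eq_trace, hXY.covMat_eq, trace_add, this, add_zero, divergence_eq_trace]

/-- The integrand of the characterization, as a square plus divergences. -/
theorem integrand_eq (hX : IsQuasiYamabeSoliton g k m lam X) (hXY : IsHodgeDecomposition g X h Y)
    (p : M) :
    ricciApply g (grad g h) Y p
        + (1 / m) * tensorInner g p (hess g h p) (vecMulVec (flat g X p) (flat g X p))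
        - (2 / m) * tensorInner g p (hess g h p) (vecMulVec (diffAt h p) (diffAt h p))
        + (1 / m ^ 2) * tensorInner g p (vecMulVec (diffAt h p) (diffAt h p))
            (vecMulVec (diffAt h p) (diffAt h p))
        + (n / (2 * m)) * (sigma g k p - lam) * normSq g X p
        + (2 / m) * (sigma g k p - lam) * normSq g (grad g h) p
        + (3 / (2 * m ^ 2)) * (normSq g X p) ^ 2 =
      defect g m (fun q ↦ sigma g k q - lam) h p + divergence g (covField g (grad g h) Y) p
        + (1 / (2 * m)) * divergence g (fun q ↦ normSq g X q • X q) p := by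
  have hh := hXY.smooth_potential
  have hm := hX.m_ne_zero
  have hV := smoothInCharts_grad g hh
  have hXs := hX.smooth.smoothInCharts
  have hYs := hXY.smooth_field.smoothInCharts
  have hGu := metricAt_isUnit g p
  have hGt := metricAt_transpose g p
  have heq := hX.equation_covMat p
  have htr := hX.divergence_eq p
  have hdiv := hXY.divergence_eq p
  have hquad := dotProduct_of_soliton heq
  have hH : (covMat g (grad g h) p * metricAt g p)ᵀ = covMat g (grad g h) p * metricAt g p := by
    rw [← hess_eq g hh, hess_transpose g hh]
  -- The soliton equation paired with ∇²h; this is how Y leaves the curvature term.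
  have hAB : covTrace g (grad g h) Y p =
      (1 / m) * (vecAt X p ⬝ᵥ hess g h p *ᵥ vecAt X p)
        + (sigma g k p - lam) * divergence g (grad g h) p
        - covTrace g (grad g h) (grad g h) p := by
    rw [covTrace_eq_trace, hess_eq g hh, divergence_eq_trace, covTrace_eq_trace]
    exact trace_mul_of_soliton hGu hGt hH (hXY.covMat_eq p ▸ heq)
  have hnn : vecAt (grad g h) p ⬝ᵥ vecMulVec (diffAt h p) (diffAt h p) *ᵥ vecAt (grad g h) p =
      normSq g (grad g h) p ^ 2 := by
    rw [vecMulVec_mulVec, dotProduct_smul, normSq_eq, diffAt_eq g hh,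
      dotProduct_comm (metricAt g p *ᵥ _)]
    simp [sq]
  rw [divergence_covField g hV hYs hXY.divergence_free, divergence_normSq_smul_eq g hXs, hquad,
    hAB, flat, tensorInner_vecMulVec]
  have ht1 := tensorInner_vecMulVec g p (hess g h p) (vecAt (grad g h) p)
  have ht2 := tensorInner_vecMulVec g p (vecMulVec (diffAt h p) (diffAt h p))
    (vecAt (grad g h) p)
  rw [← diffAt_eq g hh] at ht1 ht2
  rw [ht1, ht2, hnn, defect, divergence_normSq_smul_eq g hV, ← hess_eq g hh, ← normSq_eq, ← hdiv,
    htr]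
  -- By now (1/(2m)) div(|X|² X) is 3|X|⁴/(2m²) + (n + 2) s|X|²/(2m), the source of the last
  -- coefficient in the integrand. What is left over is s(n s − Δh + |X|²/m), zero by the traced
  -- equation.
  field_simp
  ring

/-- Cauchy–Schwarz |tr T|² ≤ n |T|². As div Y = 0, Δh = div X = |X|²/m + n s, whence tr T = (|X|² −
|∇h|²)/m. -/
theorem sq_le_defect (hX : IsQuasiYamabeSoliton g k m lam X) (hXY : IsHodgeDecomposition g X h Y)
    (p : M) :
    ((normSq g X p - normSq g (grad g h) p) / m) ^ 2 ≤
      n * defect g m (fun q ↦ sigma g k q - lam) h p := by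
  have hh := hXY.smooth_potential
  have hGu := metricAt_isUnit g p
  have hGt := metricAt_transpose g p
  rw [defect_eq g hh]
  have hS : (hess g h p - (1 / m) • vecMulVec (diffAt h p) (diffAt h p)
      - (sigma g k p - lam) • metricAt g p)ᵀ = hess g h p
        - (1 / m) • vecMulVec (diffAt h p) (diffAt h p)
        - (sigma g k p - lam) • metricAt g p := by
    simp [hess_transpose g hh, hGt, transpose_vecMulVec]
  refine le_trans (le_of_eq ?_) (sq_trace_le (metricAt_posDef g p) hS)
  congr 1
  have h1 : (hess g h p * (metricAt g p)⁻¹).trace = divergence g X p := by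
    rw [hess_eq g hh, Matrix.mul_assoc, mul_nonsing_inv _ hGu, Matrix.mul_one, hXY.divergence_eq]
    rfl
  have h2 : (vecMulVec (diffAt h p) (diffAt h p) * (metricAt g p)⁻¹).trace =
      normSq g (grad g h) p := by
    have := trace_vecMulVec_mul (metricAt g p) (metricAt g p) hGu hGt (vecAt (grad g h) p)
    rw [Matrix.mul_assoc, mul_nonsing_inv _ hGu, Matrix.mul_one, ← diffAt_eq g hh] at this
    rw [this, normSq_eq, ← diffAt_eq g hh]
  simp only [Matrix.sub_mul, Matrix.smul_mul, trace_sub, trace_smul, h1, h2,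
    mul_nonsing_inv _ hGu, trace_one, Fintype.card_fin, smul_eq_mul, hX.divergence_eq]
  ring

/-- For a gradient field ½ 𝓛_X g = ∇²h, so T = 0 is the soliton equation itself. -/
theorem defect_eq_zero (hX : IsQuasiYamabeSoliton g k m lam X)
    (hh : ContMDiff (𝓡 n) 𝓘(ℝ, ℝ) ∞ h) (hXh : X = grad g h) (p : M) :
    defect g m (fun q ↦ sigma g k q - lam) h p = 0 := by
  have heq := hX.equation_covMat p
  rw [hXh, ← hess_eq g hh, hess_transpose g hh, ← diffAt_eq g hh] at heq
  have h0 : hess g h p - (1 / m) • vecMulVec (diffAt h p) (diffAt h p)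
      - (sigma g k p - lam) • metricAt g p = 0 := by
    rw [← heq, ← two_smul ℝ (hess g h p), smul_smul]
    norm_num
  rw [defect_eq g hh, h0]
  simp

variable [CompactSpace M] [MeasurableSpace M] [BorelSpace M]

/-- The integrand is div(fY) because Y is divergence free. -/
theorem integral_inner_grad_eq_zero [T2Space M] {f : M → ℝ} (hf : ContMDiff (𝓡 n) 𝓘(ℝ, ℝ) ∞ f)
    (hY : SmoothInCharts Y) (hdiv : ∀ p, divergence g Y p = 0) :
    ∫ p, g.inner p (grad g f p) (Y p) ∂(riemannianVolume g) = 0 := by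
  rw [← integral_divergence_eq_zero g (SmoothInCharts.smul (contDiffOn_funRep hf) hY)]
  refine integral_congr_ae (Filter.Eventually.of_forall fun p ↦ ?_)
  simp only [divergence_smul_of_contMDiff g hf hY, hdiv, mul_zero, add_zero]

theorem eq_zero_of_integral_normSq (hY : SmoothInCharts Y)
    (hint : ∫ p, normSq g Y p ∂(riemannianVolume g) ≤ 0) (p : M) : Y p = 0 := by
  have h0 : ∀ p, 0 ≤ normSq g Y p := fun p ↦ by
    by_cases hp : Y p = 0
    · simp [normSq, hp]
    · exact (g.pos p _ hp).le
  by_contra hp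
  exact (g.pos p _ hp).ne' (eq_zero_of_integral_nonpos g (continuous_normSq g hY) h0 hint p)

end Soliton

end QuasiYamabe

end

/-! ### The characterization of gradient solitons. -/

theorem theorem1p2 {n : ℕ} (hn : 3 ≤ n)
    {M : Type*} [TopologicalSpace M] [ChartedSpace (EuclideanSpace ℝ (Fin n)) M]
    [IsManifold (𝓡 n) ∞ M] [T2Space M] [CompactSpace M] [MeasurableSpace M] [BorelSpace M]
    (g : ContMDiffRiemannianMetric (𝓡 n) ∞ (EuclideanSpace ℝ (Fin n))
      (fun x : M ↦ TangentSpace (𝓡 n) x))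
    (k : ℕ) (hk : 1 ≤ k) (hkn : k ≤ n) (m lam : ℝ)
    (X : (x : M) → TangentSpace (𝓡 n) x) (hX : IsQuasiYamabeSoliton g k m lam X)
    (h : M → ℝ) (Y : (x : M) → TangentSpace (𝓡 n) x) (hXY : IsHodgeDecomposition g X h Y) :
    IsGradientField g X ↔
      ∫ p, (ricciApply g (grad g h) Y p
        + (1 / m) * tensorInner g p (hess g h p) (Matrix.vecMulVec (flat g X p) (flat g X p))
        - (2 / m) * tensorInner g p (hess g h p) (Matrix.vecMulVec (diffAt h p) (diffAt h p))
        + (1 / m ^ 2) * tensorInner g p (Matrix.vecMulVec (diffAt h p) (diffAt h p))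
            (Matrix.vecMulVec (diffAt h p) (diffAt h p))
        + (n / (2 * m)) * (sigma g k p - lam) * normSq g X p
        + (2 / m) * (sigma g k p - lam) * normSq g (grad g h) p
        + (3 / (2 * m ^ 2)) * (normSq g X p) ^ 2) ∂(riemannianVolume g) ≤ 0 := by
  have hn0 : n ≠ 0 := by omega
  have hnpos : (0 : ℝ) < n := by exact_mod_cast Nat.pos_of_ne_zero hn0
  have hh := hXY.smooth_potential
  have hV := smoothInCharts_grad g hh
  have hXs := hX.smooth.smoothInCharts
  have hYs := hXY.smooth_field.smoothInCharts
  have hhY := integral_inner_grad_eq_zero hh hYs hXY.divergence_free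
  have hcd := continuous_defect g hh m (hX.continuous_sigma hn0)
  have hW := hV.covField g hYs
  have hXX := hXs.normSq_smul g
  have hI : ∀ {f₁ f₂ f₃ : M → ℝ}, Continuous f₁ → Continuous f₂ → Continuous f₃ →
      ∫ p, (f₁ p + f₂ p + (1 / (2 * m)) * f₃ p) ∂(riemannianVolume g) =
        ∫ p, f₁ p ∂(riemannianVolume g) + ∫ p, f₂ p ∂(riemannianVolume g)
          + (1 / (2 * m)) * ∫ p, f₃ p ∂(riemannianVolume g) := by
    intro f₁ f₂ f₃ h₁ h₂ h₃
    rw [integral_add (integrable_of_continuous g (h₁.fun_add h₂))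
        ((integrable_of_continuous g h₃).const_mul _),
      integral_add (integrable_of_continuous g h₁) (integrable_of_continuous g h₂),
      integral_const_mul]
  simp only [integrand_eq hX hXY]
  rw [hI hcd (continuous_divergence g hW) (continuous_divergence g hXX),
    integral_divergence_eq_zero g hW, integral_divergence_eq_zero g hXX, mul_zero, add_zero,
    add_zero]
  constructor
  · rintro ⟨f, hf, hXf⟩
    have hfY := integral_inner_grad_eq_zero hf hYs hXY.divergence_free
    -- The given potential f need not be h, but Y = ∇f − ∇h, and Y is orthogonal to both gradients
    -- in L².
    have hY0 : ∀ p, Y p = 0 := by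
      refine eq_zero_of_integral_normSq (g := g) hYs (le_of_eq ?_)
      have h1 : ∀ p, normSq g Y p =
          g.inner p (grad g f p) (Y p) - g.inner p (grad g h p) (Y p) := by
        intro p
        have h2 : Y p = grad g f p - grad g h p := by
          rw [← hXf p, hXY.decomposition p, add_sub_cancel_left]
        rw [normSq, ← sub_apply, ← map_sub, ← h2]
      simp only [h1]
      rw [integral_sub
        (integrable_of_continuous g
          (smoothFun_inner g (smoothInCharts_grad g hf) hYs).continuous)
        (integrable_of_continuous g (smoothFun_inner g hV hYs).continuous), hfY, hhY, sub_zero]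
    have hXh : X = grad g h := by
      funext p
      rw [hXY.decomposition p, hY0 p, add_zero]
    simp only [defect_eq_zero hX hh hXh]
    simp
  · intro hle
    have hsq := fun p ↦ sq_le_defect hX hXY p
    have hd0 : ∀ p, 0 ≤ defect g m (fun q ↦ sigma g k q - lam) h p := fun p ↦ by
      have := (sq_nonneg _).trans (hsq p)
      exact nonneg_of_mul_nonneg_right this hnpos
    have hnorm : ∀ p, normSq g X p = normSq g (grad g h) p := by
      intro p
      have h1 := hsq p
      rw [eq_zero_of_integral_nonpos g hcd hd0 hle p, mul_zero] at h1
      have h2 := pow_eq_zero_iff (two_ne_zero) |>.1 (le_antisymm h1 (sq_nonneg _))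
      rcases div_eq_zero_iff.1 h2 with h3 | h3
      · linarith
      · exact absurd h3 hX.m_ne_zero
    have hY0 : ∀ p, Y p = 0 := by
      refine eq_zero_of_integral_normSq (g := g) hYs (le_of_eq ?_)
      -- Expand |∇h + Y|² = |∇h|²; the right-hand side then integrates to zero by orthogonality.
      have h1 : ∀ p, normSq g Y p = (-2) * g.inner p (grad g h p) (Y p) := by
        intro p
        have h2 := hnorm p
        rw [normSq, hXY.decomposition p] at h2
        simp only [map_add, add_apply] at h2
        rw [g.symm p (Y p) (grad g h p)] at h2
        rw [normSq]
        rw [normSq] at h2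
        linarith
      simp only [h1]
      rw [integral_const_mul, hhY, mul_zero]
    exact ⟨h, hh, fun p ↦ by rw [hXY.decomposition p, hY0 p, add_zero]⟩
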